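/- **Conventions.** Let $M$ be a smooth manifold of dimension $n$, let $P$ be a pseudogroup of local diffeomorphisms of $M$, and let $X=M/P$. Let $S_2(M)$ be the bundle of second order frames of $M$: the manifold of $2$-jets $j^2_0k$ at $0\in\mathbb R^n$ of smooth maps $k$ from a neighbourhood of $0$ to $M$ that are regular at $0$. A chart of $M$ in which $k$ is written $z^i=k^i(t^1,\dots,t^n)$ induces on $S_2(M)$ the coordinates $$y^i=k^i(0),\qquad y^i_j=\frac{\partial k^i}{\partial t^j}(0),\qquad y^i_{jk}=v^p_j\,\frac{\partial^2k^i}{\partial t^p\partial t^q}(0)\,v^q_k ,$$ where $(v^i_j)$ is the inverse of the matrix $(y^i_j)$ and repeated indices are summed. Every $e\in P$ acts on $S_2(M)$ by $j^2_0k\mapsto j^2_0(e\circ k)$. The forms in $\Omega^*(S_2(X))$ are the smooth forms on $S_2(M)$ invariant under this action of $P$, and $H^*(S_2(X))$ is the cohomology of the complex $(\Omega^*(S_2(X)),d)$. Let $\Gamma_1=\theta^i_i$ be the trace of the canonical (Gelfand–Kazhdan) forms $\theta^i_j$; that is, $\Gamma_1$ is the $1$-form on $S_2(M)$ such that, for every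 smooth family $k_u$ of local diffeomorphisms from neighbourhoods of $0\in\mathbb R^n$ to $M$, $$\Gamma_1\Big(\tfrac{d}{du}\Big|_{u=0} j^2_0k_u\Big)=\sum_i\frac{\partial\xi^i}{\partial t^i}(0),\qquad \xi(t)=-\tfrac{d}{du}\Big|_{u=0}(k_0^{-1}\circ k_u)(t).$$ **Proposition.** There is exactly one such form $\Gamma_1$. It belongs to $\Omega^1(S_2(X))$, and the form $\Gamma_1\wedge(d\Gamma_1)^n$ is a closed element of $\Omega^{2n+1}(S_2(X))$. Its class $[\Gamma_1\wedge(d\Gamma_1)^n]\in H^{2n+1}(S_2(X))$ (the Godbillon–Vey–Losik class of $X$ with values in $H^{2n+1}(S_2(X))$) is represented by a closed form in $\Omega^{2n+1}(S_2(X))$ which, in the coordinates $y^i,y^i_j,y^i_{jk}$ induced by any chart of $M$, is equal to $$-v^j_i\,dy^i_j\wedge\big(dy^k_{kl}\wedge dy^l\big)^n .$$ -/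

import Mathlib

open scoped Manifold ContDiff

noncomputable section

namespace Losik

open Set Filter Function
open scoped Topology

/-- The model space `ℝⁿ`. -/
abbrev Euc (n : ℕ) := EuclideanSpace ℝ (Fin n)

/-- The standard basis of `ℝⁿ`. -/
abbrev stdVec {n : ℕ} (j : Fin n) : Euc n := EuclideanSpace.single j 1

/-- The model space of the bundle of second order frames. A point `y` has the coordinates
`yⁱ = y.1 i`, `yⁱⱼ = y.2.1 (stdVec j) i` and `yⁱⱼₖ = y.2.2 s(j, k) i` (symmetric in `j`, `k`). -/
abbrev FrameModel (n : ℕ) := Euc n × (Euc n →L[ℝ] Euc n) × (Sym2 (Fin n) → Euc n)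

/-- The data of a two-jet at `0` of a map between open subsets of `ℝⁿ`: the value, the derivative
and the array of the second order partial derivatives. -/
abbrev JetData (n : ℕ) := Euc n × (Euc n →L[ℝ] Euc n) × (Fin n → Fin n → Euc n)

/-- The second order partial derivatives `∂²F / ∂tᵖ ∂tᑫ` at `x`. -/
def partial₂ {n : ℕ} (F : Euc n → Euc n) (x : Euc n) (p q : Fin n) : Euc n :=
  fderiv ℝ (fun t => fderiv ℝ F t (stdVec p)) x (stdVec q)

/-- The two-jet at `0`. -/
def jet {n : ℕ} (F : Euc n → Euc n) : JetData n := (F 0, fderiv ℝ F 0, partial₂ F 0)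

/-- The array `∑ Lᵖⱼ a_pq Lᑫₖ`. -/
def contract {n : ℕ} (a : Fin n → Fin n → Euc n) (L : Euc n →L[ℝ] Euc n) (j k : Fin n) : Euc n :=
  ∑ p, ∑ q, (L (stdVec j) p * L (stdVec k) q) • a p q

/-- A two-index array as a function of unordered pairs; symmetric arrays are left unchanged. -/
def symArray {n : ℕ} (a : Fin n → Fin n → Euc n) : Sym2 (Fin n) → Euc n :=
  Sym2.lift ⟨fun j k => (2⁻¹ : ℝ) • (a j k + a k j), fun _ _ => congrArg ((2⁻¹ : ℝ) • ·) (add_comm _ _)⟩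

/-- The action of a map `h` on two-jets by composition from the left. -/
def jetComp {n : ℕ} (h : Euc n → Euc n) (z : JetData n) : JetData n :=
  (h z.1, (fderiv ℝ h z.1).comp z.2.1,
    fun p q => contract (partial₂ h z.1) z.2.1 p q + fderiv ℝ h z.1 (z.2.2 p q))

section Jets

variable {n : ℕ}

theorem two_le_infty : (2 : WithTop ℕ∞) ≤ ∞ := by
  exact ENat.LEInfty.out

theorem symArray_mk {a : Fin n → Fin n → Euc n} (h : ∀ j k, a j k = a k j) (j k : Fin n) :
    symArray a s(j, k) = a j k := by
  have : symArray a s(j, k) = (2⁻¹ : ℝ) • (a j k + a k j) := rfl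
  rw [this, ← h j k, ← two_smul ℝ, smul_smul]
  norm_num

theorem sum_stdVec (x : Euc n) : ∑ p, x p • stdVec p = x := by
  ext i
  simp [Pi.single_apply]

theorem map_sum_stdVec (L : Euc n →L[ℝ] Euc n) (x : Euc n) : ∑ p, x p • L (stdVec p) = L x := by
  conv_rhs => rw [← sum_stdVec x]
  simp

theorem contract_contract (a : Fin n → Fin n → Euc n) (L K : Euc n →L[ℝ] Euc n) :
    contract (contract a L) K = contract a (L.comp K) := by
  funext j k
  have hL : ∀ (x : Euc n) (i : Fin n), L x i = ∑ p, x p * L (stdVec p) i := by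
    intro x i
    conv_lhs => rw [← map_sum_stdVec L x]
    simp
  have e1 : ∀ p q : Fin n, ((L.comp K) (stdVec j) p * (L.comp K) (stdVec k) q) • a p q =
      ∑ r, ∑ s, (K (stdVec j) r * K (stdVec k) s) •
        (L (stdVec r) p * L (stdVec s) q) • a p q := by
    intro p q
    rw [ContinuousLinearMap.comp_apply, ContinuousLinearMap.comp_apply, hL (K (stdVec j)),
      hL (K (stdVec k)), Finset.sum_mul_sum, Finset.sum_smul]
    refine Finset.sum_congr rfl fun r _ => ?_
    rw [Finset.sum_smul]
    refine Finset.sum_congr rfl fun s _ => ?_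
    rw [smul_smul]
    congr 1
    ring
  have e2 : contract a (L.comp K) j k = ∑ p, ∑ q, ∑ r, ∑ s, (K (stdVec j) r * K (stdVec k) s) •
        (L (stdVec r) p * L (stdVec s) q) • a p q :=
    Finset.sum_congr rfl fun p _ => Finset.sum_congr rfl fun q _ => e1 p q
  rw [e2]
  simp only [contract, Finset.smul_sum]
  calc _ = ∑ r, ∑ p, ∑ s, ∑ q, (K (stdVec j) r * K (stdVec k) s) •
        (L (stdVec r) p * L (stdVec s) q) • a p q :=
        Finset.sum_congr rfl fun r _ => Finset.sum_comm
    _ = ∑ p, ∑ r, ∑ s, ∑ q, (K (stdVec j) r * K (stdVec k) s) •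
        (L (stdVec r) p * L (stdVec s) q) • a p q := Finset.sum_comm
    _ = ∑ p, ∑ r, ∑ q, ∑ s, (K (stdVec j) r * K (stdVec k) s) •
        (L (stdVec r) p * L (stdVec s) q) • a p q :=
        Finset.sum_congr rfl fun p _ => Finset.sum_congr rfl fun r _ => Finset.sum_comm
    _ = _ := Finset.sum_congr rfl fun p _ => Finset.sum_comm

theorem contract_id (a : Fin n → Fin n → Euc n) :
    contract a (ContinuousLinearMap.id ℝ (Euc n)) = a := by
  funext j k
  simp [contract, PiLp.single_apply]

theorem contract_symm {a : Fin n → Fin n → Euc n} (h : ∀ j k, a j k = a k j)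
    (L : Euc n →L[ℝ] Euc n) (j k : Fin n) : contract a L j k = contract a L k j := by
  unfold contract
  rw [Finset.sum_comm]
  refine Finset.sum_congr rfl fun p _ => Finset.sum_congr rfl fun q _ => ?_
  rw [h, mul_comm]

theorem jet_congr {F G : Euc n → Euc n} (h : F =ᶠ[𝓝 0] G) : jet F = jet G := by
  unfold jet
  rw [h.eq_of_nhds, h.fderiv_eq]
  refine Prod.ext rfl (Prod.ext rfl ?_)
  funext p q
  have : (fun t => fderiv ℝ F t (stdVec p)) =ᶠ[𝓝 0] fun t => fderiv ℝ G t (stdVec p) :=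
    h.fderiv.fun_comp (fun L => L (stdVec p))
  exact congrArg (fun L : Euc n →L[ℝ] Euc n => L (stdVec q)) this.fderiv_eq

theorem differentiableAt_partial {F : Euc n → Euc n} {x : Euc n} (hF : ContDiffAt ℝ 2 F x)
    (v : Euc n) : DifferentiableAt ℝ (fun t => fderiv ℝ F t v) x :=
  ((hF.fderiv_right (m := 1) (by norm_num)).differentiableAt (by simp)).clm_apply
    (differentiableAt_const v)

theorem partial₂_symm {F : Euc n → Euc n} {x : Euc n} (hF : ContDiffAt ℝ 2 F x) (p q : Fin n) :
    partial₂ F x p q = partial₂ F x q p := by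
  have d : DifferentiableAt ℝ (fderiv ℝ F) x :=
    (hF.fderiv_right (m := 1) (by norm_num)).differentiableAt (by simp)
  have e : ∀ p q, partial₂ F x p q = fderiv ℝ (fderiv ℝ F) x (stdVec q) (stdVec p) := by
    intro p q
    have := (d.hasFDerivAt.clm_apply (hasFDerivAt_const (stdVec p) x)).fderiv
    unfold partial₂
    rw [this]
    simp
  rw [e, e]
  exact (hF.isSymmSndFDerivAt (by simp)) _ _

theorem jet_comp {h F : Euc n → Euc n} (hh : ContDiffAt ℝ 2 h (F 0))
    (hF : ContDiffAt ℝ 2 F 0) : jet (h ∘ F) = jetComp h (jet F) := by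
  have hh' : ∀ᶠ x in 𝓝 (F 0), ContDiffAt ℝ 2 h x := hh.eventually (by simp)
  have hF' : ∀ᶠ t in 𝓝 (0 : Euc n), ContDiffAt ℝ 2 F t := hF.eventually (by simp)
  have e : fderiv ℝ (h ∘ F) =ᶠ[𝓝 0] fun t => (fderiv ℝ h (F t)).comp (fderiv ℝ F t) := by
    filter_upwards [hF.continuousAt.eventually hh', hF'] with t h1 h2
    exact fderiv_comp t (h1.differentiableAt (by simp)) (h2.differentiableAt (by simp))
  have d3 : DifferentiableAt ℝ F 0 := hF.differentiableAt (by simp)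
  refine Prod.ext rfl (Prod.ext e.eq_of_nhds ?_)
  funext p q
  have e1 : (fun t => fderiv ℝ (h ∘ F) t (stdVec p)) =ᶠ[𝓝 0]
      fun t => ∑ r, (fderiv ℝ F t (stdVec p)) r • fderiv ℝ h (F t) (stdVec r) := by
    filter_upwards [e] with t ht
    rw [ht, map_sum_stdVec, ContinuousLinearMap.comp_apply]
  have hterm : ∀ r : Fin n, HasFDerivAt
      (fun t => (fderiv ℝ F t (stdVec p)) r • fderiv ℝ h (F t) (stdVec r)) _ 0 := fun r =>
    ((EuclideanSpace.proj (𝕜 := ℝ) r).hasFDerivAt.comp (0 : Euc n)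
      (differentiableAt_partial hF (stdVec p)).hasFDerivAt).smul
      ((differentiableAt_partial hh (stdVec r)).hasFDerivAt.comp (0 : Euc n) d3.hasFDerivAt)
  have e2 := (e1.fderiv_eq).trans (HasFDerivAt.fun_sum (u := Finset.univ) fun r _ => hterm r).fderiv
  have e3 := congrArg (fun L : Euc n →L[ℝ] Euc n => L (stdVec q)) e2
  refine e3.trans ?_
  simp only [sum_apply, add_apply, smul_apply, ContinuousLinearMap.smulRight_apply,
    ContinuousLinearMap.comp_apply, Finset.sum_add_distrib]
  refine congrArg₂ (· + ·) ?_ ?_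
  · refine Finset.sum_congr rfl fun r _ => ?_
    rw [← map_sum_stdVec (fderiv ℝ (fun t => fderiv ℝ h t (stdVec r)) (F 0)), Finset.smul_sum]
    refine Finset.sum_congr rfl fun s _ => ?_
    rw [smul_smul]
    rfl
  · exact map_sum_stdVec _ _

/-- The quadratic map with value `y`, derivative the identity and second partial derivatives `a` at
`0`. -/
def quadForm (y : Euc n) (a : Sym2 (Fin n) → Euc n) (x : Euc n) : Euc n :=
  y + x + (2⁻¹ : ℝ) • ∑ j, ∑ k, (x j * x k) • a s(j, k)

theorem contDiff_coord (j : Fin n) : ContDiff ℝ ∞ (fun x : Euc n => x j) :=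
  (EuclideanSpace.proj (𝕜 := ℝ) j).contDiff

theorem contDiff_quadForm (y : Euc n) (a : Sym2 (Fin n) → Euc n) :
    ContDiff ℝ ∞ (quadForm y a) :=
  (contDiff_const.add contDiff_id).add (ContDiff.const_smul _ (ContDiff.sum fun j _ =>
    ContDiff.sum fun k _ => ((contDiff_coord j).mul (contDiff_coord k)).smul contDiff_const))

theorem hasFDerivAt_coord (j : Fin n) (x : Euc n) :
    HasFDerivAt (fun x : Euc n => x j) (EuclideanSpace.proj (𝕜 := ℝ) j) x :=
  (EuclideanSpace.proj (𝕜 := ℝ) j).hasFDerivAt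

theorem fderiv_quadForm (y : Euc n) (a : Sym2 (Fin n) → Euc n) (x v : Euc n) :
    fderiv ℝ (quadForm y a) x v =
      v + (2⁻¹ : ℝ) • ∑ j, ∑ k, (x j * v k + x k * v j) • a s(j, k) := by
  have h := ((hasFDerivAt_id x).const_add y).add ((HasFDerivAt.fun_sum (u := Finset.univ)
    fun j _ => HasFDerivAt.fun_sum (u := Finset.univ) fun k _ =>
      ((hasFDerivAt_coord j x).mul (hasFDerivAt_coord k x)).smul_const (a s(j, k))).const_smul
        (2⁻¹ : ℝ))
  have h' : HasFDerivAt (quadForm y a) _ x := h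
  rw [h'.fderiv]
  simp

theorem jet_quadForm (y : Euc n) (a : Sym2 (Fin n) → Euc n) :
    jet (quadForm y a) = (y, ContinuousLinearMap.id ℝ (Euc n), fun j k => a s(j, k)) := by
  refine Prod.ext ?_ (Prod.ext ?_ ?_)
  · simp [jet, quadForm]
  · ext v : 1
    change fderiv ℝ (quadForm y a) 0 v = v
    rw [fderiv_quadForm]
    simp
  · funext p q
    change fderiv ℝ (fun t => fderiv ℝ (quadForm y a) t (stdVec p)) 0 (stdVec q) = a s(p, q)
    have e : (fun t => fderiv ℝ (quadForm y a) t (stdVec p)) = fun t : Euc n =>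
        stdVec p + (2⁻¹ : ℝ) • ∑ j, ∑ k, (t j * (stdVec p : Euc n) k +
          t k * (stdVec p : Euc n) j) • a s(j, k) := by
      funext t
      exact fderiv_quadForm y a t _
    have h := ((HasFDerivAt.fun_sum (u := Finset.univ)
      fun j _ => HasFDerivAt.fun_sum (u := Finset.univ) fun k _ =>
        ((((hasFDerivAt_coord j (0 : Euc n)).mul_const ((stdVec p : Euc n) k)).add
          ((hasFDerivAt_coord k (0 : Euc n)).mul_const ((stdVec p : Euc n) j))).smul_const
            (a s(j, k)))).const_smul (2⁻¹ : ℝ)).const_add (stdVec p : Euc n)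
    have h' : HasFDerivAt (fun t : Euc n =>
        stdVec p + (2⁻¹ : ℝ) • ∑ j, ∑ k, (t j * (stdVec p : Euc n) k +
          t k * (stdVec p : Euc n) j) • a s(j, k)) _ 0 := h
    rw [e, h'.fderiv]
    have e2 : ∀ j k : Fin n, (((stdVec p : Euc n) k • EuclideanSpace.proj (𝕜 := ℝ) j +
        (stdVec p : Euc n) j • EuclideanSpace.proj (𝕜 := ℝ) k).smulRight (a s(j, k)) :
          Euc n →L[ℝ] Euc n) (stdVec q) =
        (if j = q then if k = p then a s(j, k) else 0 else 0) +
          (if k = q then if j = p then a s(j, k) else 0 else 0) := by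
      intro j k
      have : (((stdVec p : Euc n) k • EuclideanSpace.proj (𝕜 := ℝ) j +
        (stdVec p : Euc n) j • EuclideanSpace.proj (𝕜 := ℝ) k).smulRight (a s(j, k)) :
          Euc n →L[ℝ] Euc n) (stdVec q) = ((stdVec p : Euc n) k * (stdVec q : Euc n) j +
            (stdVec p : Euc n) j * (stdVec q : Euc n) k) • a s(j, k) := rfl
      rw [this, add_smul]
      simp only [PiLp.single_apply, mul_ite, mul_one, mul_zero, ite_smul, one_smul, zero_smul]
    simp only [smul_apply, sum_apply, e2, Finset.sum_add_distrib, Finset.sum_ite_eq',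
      Finset.mem_univ, if_true]
    simp [Sym2.eq_swap (a := q), ← two_smul ℝ, smul_smul]

theorem jet_clm (L : Euc n →L[ℝ] Euc n) : jet (L : Euc n → Euc n) = (0, L, 0) := by
  refine Prod.ext (by simp [jet]) (Prod.ext (by simp [jet]) ?_)
  funext p q
  simp [jet, partial₂]

/-- The quadratic map with the coordinates `y`. -/
def quadMap (y : FrameModel n) : Euc n → Euc n := quadForm y.1 y.2.2 ∘ y.2.1

theorem contDiff_quadMap (y : FrameModel n) : ContDiff ℝ ∞ (quadMap y) :=
  (contDiff_quadForm y.1 y.2.2).comp y.2.1.contDiff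

/-- From the coordinates `y` to the coordinates `z`. -/
def yToZ (y : FrameModel n) : JetData n :=
  (y.1, y.2.1, contract (fun j k => y.2.2 s(j, k)) y.2.1)

theorem jet_quadMap (y : FrameModel n) : jet (quadMap y) = yToZ y := by
  have h0 : y.2.1 0 = 0 := map_zero _
  have hq := jet_quadForm y.1 y.2.2
  have q1 : quadForm y.1 y.2.2 0 = y.1 := congrArg Prod.fst hq
  have q2 : fderiv ℝ (quadForm y.1 y.2.2) 0 = _ := congrArg (fun z => z.2.1) hq
  have q3 : partial₂ (quadForm y.1 y.2.2) 0 = _ := congrArg (fun z => z.2.2) hq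
  unfold quadMap
  rw [jet_comp ((contDiff_quadForm _ _).contDiffAt.of_le two_le_infty) y.2.1.contDiff.contDiffAt,
    jet_clm]
  simp only [jetComp, q1, q2, q3, yToZ]
  refine Prod.ext rfl (Prod.ext (by simp) ?_)
  funext p q
  simp

/-- From the coordinates `z` to the coordinates `y`: `yⁱⱼₖ = vᵖⱼ zⁱ_pq vᑫₖ` with `v = (zⁱⱼ)⁻¹`. -/
def zToY (z : JetData n) : FrameModel n :=
  (z.1, z.2.1, symArray (contract z.2.2 z.2.1.inverse))

theorem zToY_yToZ {y : FrameModel n} (hy : y.2.1.IsInvertible) : zToY (yToZ y) = y := by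
  refine Prod.ext rfl (Prod.ext rfl ?_)
  have e : y.2.1.comp y.2.1.inverse = ContinuousLinearMap.id ℝ (Euc n) := by
    ext1 x
    simp [hy.self_apply_inverse]
  simp only [zToY, yToZ, contract_contract, e, contract_id]
  funext s
  induction s using Sym2.ind with
  | _ j k => exact symArray_mk (fun j k => by rw [Sym2.eq_swap]) j k

theorem yToZ_zToY {z : JetData n} (hz : z.2.1.IsInvertible)
    (hs : ∀ p q, z.2.2 p q = z.2.2 q p) : yToZ (zToY z) = z := by
  refine Prod.ext rfl (Prod.ext rfl ?_)
  have e : z.2.1.inverse.comp z.2.1 = ContinuousLinearMap.id ℝ (Euc n) := by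
    ext1 x
    simp [hz.inverse_apply_self]
  have e2 : (fun j k => symArray (contract z.2.2 z.2.1.inverse) s(j, k)) =
      contract z.2.2 z.2.1.inverse := by
    funext j k
    exact symArray_mk (contract_symm hs _) j k
  simp only [zToY, yToZ]
  rw [e2, contract_contract, e, contract_id]

end Jets

section FrameBundle

variable {n : ℕ}
variable {M : Type*} [TopologicalSpace M] [ChartedSpace (Euc n) M]

variable (n) in
/-- A local diffeomorphism of `M`, defined on an open subset of `M`. -/
def IsLocalDiffeo (e : OpenPartialHomeomorph M M) : Prop :=
  ContMDiffOn (𝓡 n) (𝓡 n) ∞ e e.source ∧ ContMDiffOn (𝓡 n) (𝓡 n) ∞ e.symm e.target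

variable (n M) in
/-- A diffeomorphism of an open neighbourhood of `0 ∈ ℝⁿ` onto an open subset of `M`, that is, a
representative of a germ at `0` of maps `ℝⁿ → M` that are regular at `0`. -/
structure LocalParam where
  toHomeo : OpenPartialHomeomorph (Euc n) M
  zero_mem : (0 : Euc n) ∈ toHomeo.source
  smooth : ContMDiffOn (𝓡 n) (𝓡 n) ∞ toHomeo toHomeo.source
  smooth_symm : ContMDiffOn (𝓡 n) (𝓡 n) ∞ toHomeo.symm toHomeo.target

variable (n M) in
/-- The smooth charts of `M`. -/
abbrev charts : Set (OpenPartialHomeomorph M (Euc n)) :=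
  IsManifold.maximalAtlas (𝓡 n) ∞ M

variable (n M) in
/-- Two parametrizations have the same two-jet at `0` if they have the same value at `0` and, in
every smooth chart around that value, the same first and second derivatives at `0`. -/
def jetSetoid : Setoid (LocalParam n M) where
  r f g := LocalParam.toHomeo f 0 = g.toHomeo 0 ∧ ∀ φ ∈ charts n M, f.toHomeo 0 ∈ φ.source →
    jet (φ ∘ f.toHomeo) = jet (φ ∘ g.toHomeo)
  iseqv :=
    { refl := fun _ => ⟨rfl, fun _ _ _ => rfl⟩
      symm := fun h => ⟨h.1.symm, fun φ hφ h0 => (h.2 φ hφ (h.1 ▸ h0)).symm⟩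
      trans := fun h h' => ⟨h.1.trans h'.1, fun φ hφ h0 =>
        (h.2 φ hφ h0).trans (h'.2 φ hφ (h.1 ▸ h0))⟩ }

variable (n M) in
/-- The bundle `S₂(M)` of second order frames: two-jets at `0 ∈ ℝⁿ` of regular maps into `M`. -/
def Frame₂ : Type _ := Quotient (jetSetoid n M)

/-- The two-jet of a parametrization. -/
def j2 (f : LocalParam n M) : Frame₂ n M := Quotient.mk (jetSetoid n M) f

/-- The projection `S₂(M) → M`. -/
def proj (s : Frame₂ n M) : M := Quotient.lift (fun f : LocalParam n M => f.toHomeo 0) (fun _ _ h => And.left h) s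

/-- The two-jet of a parametrization read in a chart of `M`: the coordinates `zⁱ, zⁱⱼ, zⁱⱼₖ`. -/
def zCoord (φ : OpenPartialHomeomorph M (Euc n)) (s : Frame₂ n M) : JetData n :=
  jet (φ ∘ (Quotient.out s : LocalParam n M).toHomeo)

/-- The coordinates `yⁱ, yⁱⱼ, yⁱⱼₖ` on `S₂(M)` induced by a chart of `M`. -/
def yCoord (φ : OpenPartialHomeomorph M (Euc n)) (s : Frame₂ n M) : FrameModel n :=
  zToY (zCoord φ s)

theorem j2_out (s : Frame₂ n M) : j2 (Quotient.out s : LocalParam n M) = s := Quotient.out_eq s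

theorem proj_out (s : Frame₂ n M) : (Quotient.out s : LocalParam n M).toHomeo 0 = proj s :=
  congrArg proj (j2_out s)

theorem zCoord_j2 {φ : OpenPartialHomeomorph M (Euc n)} (hφ : φ ∈ charts n M)
    (f : LocalParam n M) (hf : f.toHomeo 0 ∈ φ.source) :
    zCoord φ (j2 f) = jet (φ ∘ f.toHomeo) := by
  have h : (jetSetoid n M).r (Quotient.out (j2 f) : LocalParam n M) f := Quotient.mk_out f
  exact h.2 φ hφ (h.1.symm ▸ hf)

theorem contDiffAt_chart {φ : OpenPartialHomeomorph M (Euc n)} (hφ : φ ∈ charts n M)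
    (f : LocalParam n M) (hf : f.toHomeo 0 ∈ φ.source) :
    ContDiffAt ℝ ∞ (φ ∘ f.toHomeo) 0 := by
  rw [← contMDiffAt_iff_contDiffAt]
  exact (contMDiffAt_of_mem_maximalAtlas hφ hf).comp 0
    (f.smooth.contMDiffAt (f.toHomeo.open_source.mem_nhds f.zero_mem))

theorem contDiffOn_transition {φ ψ : OpenPartialHomeomorph M (Euc n)} (hφ : φ ∈ charts n M)
    (hψ : ψ ∈ charts n M) : ContDiffOn ℝ ∞ (ψ ∘ φ.symm) (φ.symm.trans ψ).source := by
  rw [← contMDiffOn_iff_contDiffOn]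
  exact (contMDiffOn_of_mem_maximalAtlas hψ).comp
    ((contMDiffOn_symm_of_mem_maximalAtlas hφ).mono (by simp)) (by
      intro x hx
      simpa using hx.2)

theorem jet_chart_change {φ ψ : OpenPartialHomeomorph M (Euc n)} (hφ : φ ∈ charts n M)
    (hψ : ψ ∈ charts n M) (f : LocalParam n M) (hf : f.toHomeo 0 ∈ φ.source)
    (hf' : f.toHomeo 0 ∈ ψ.source) :
    jet (ψ ∘ f.toHomeo) = jetComp (ψ ∘ φ.symm) (jet (φ ∘ f.toHomeo)) := by
  have hc : ContinuousAt f.toHomeo 0 := f.toHomeo.continuousAt f.zero_mem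
  have e : ψ ∘ f.toHomeo =ᶠ[𝓝 0] (ψ ∘ φ.symm) ∘ (φ ∘ f.toHomeo) := by
    filter_upwards [hc.eventually (φ.open_source.mem_nhds hf)] with t ht
    simp [φ.left_inv ht]
  rw [jet_congr e]
  have hm : (φ ∘ f.toHomeo) 0 ∈ (φ.symm.trans ψ).source := by
    simp [φ.map_source hf, φ.left_inv hf, hf']
  exact jet_comp
    (((contDiffOn_transition hφ hψ).contDiffAt ((φ.symm.trans ψ).open_source.mem_nhds hm)).of_le
      two_le_infty)
    ((contDiffAt_chart hφ f hf).of_le two_le_infty)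

theorem isInvertible_chart {φ : OpenPartialHomeomorph M (Euc n)} (hφ : φ ∈ charts n M)
    (f : LocalParam n M) (hf : f.toHomeo 0 ∈ φ.source) :
    (fderiv ℝ (φ ∘ f.toHomeo) 0).IsInvertible := by
  have hF := contDiffAt_chart hφ f hf
  have hG : ContDiffAt ℝ ∞ (f.toHomeo.symm ∘ φ.symm) ((φ ∘ f.toHomeo) 0) := by
    rw [← contMDiffAt_iff_contDiffAt]
    refine ContMDiffAt.comp (I' := 𝓡 n) _ ?_
      (contMDiffAt_symm_of_mem_maximalAtlas hφ (φ.map_source hf))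
    simp only [comp_apply, φ.left_inv hf]
    exact f.smooth_symm.contMDiffAt
      (f.toHomeo.open_target.mem_nhds (f.toHomeo.map_source f.zero_mem))
  have dF := (hF.differentiableAt (by simp)).hasFDerivAt
  have dG := (hG.differentiableAt (by simp)).hasFDerivAt
  have hc : ContinuousAt f.toHomeo 0 := f.toHomeo.continuousAt f.zero_mem
  have e : (f.toHomeo.symm ∘ φ.symm) ∘ (φ ∘ f.toHomeo) =ᶠ[𝓝 0] id := by
    filter_upwards [hc.eventually (φ.open_source.mem_nhds hf),
      f.toHomeo.open_source.mem_nhds f.zero_mem] with t ht ht'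
    simp [φ.left_inv ht, f.toHomeo.left_inv ht']
  have hs : (φ ∘ f.toHomeo) 0 ∈ (φ.symm.trans f.toHomeo.symm).source := by
    simp [φ.map_source hf, φ.left_inv hf, f.toHomeo.map_source f.zero_mem]
  have e' : (φ ∘ f.toHomeo) ∘ (f.toHomeo.symm ∘ φ.symm) =ᶠ[𝓝 ((φ ∘ f.toHomeo) 0)] id := by
    filter_upwards [(φ.symm.trans f.toHomeo.symm).open_source.mem_nhds hs] with t ht
    have h1 : t ∈ φ.target := ht.1
    have h2 : φ.symm t ∈ f.toHomeo.target := ht.2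
    simp [f.toHomeo.right_inv h2, φ.right_inv h1]
  have h0 : (f.toHomeo.symm ∘ φ.symm) ((φ ∘ f.toHomeo) 0) = 0 := e.eq_of_nhds
  have h1 := (dG.comp 0 dF).unique ((hasFDerivAt_id 0).congr_of_eventuallyEq e)
  have dF' := dF
  rw [← h0] at dF'
  have h2 := (dF'.comp _ dG).unique ((hasFDerivAt_id _).congr_of_eventuallyEq e')
  rw [h0] at h2
  exact ⟨ContinuousLinearEquiv.equivOfInverse _ _
    (fun x => congrArg (fun A : Euc n →L[ℝ] Euc n => A x) h1)
    (fun x => congrArg (fun A : Euc n →L[ℝ] Euc n => A x) h2), rfl⟩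

theorem symm_chart {φ : OpenPartialHomeomorph M (Euc n)} (hφ : φ ∈ charts n M)
    (f : LocalParam n M) (hf : f.toHomeo 0 ∈ φ.source) (p q : Fin n) :
    partial₂ (φ ∘ f.toHomeo) 0 p q = partial₂ (φ ∘ f.toHomeo) 0 q p :=
  partial₂_symm ((contDiffAt_chart hφ f hf).of_le two_le_infty) p q

/-- The domain of the coordinates `y` in the model space. -/
def frameTarget (φ : OpenPartialHomeomorph M (Euc n)) : Set (FrameModel n) :=
  {y | y.1 ∈ φ.target ∧ y.2.1.IsInvertible}

/-- The inverse function theorem, in the form needed for frames. -/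
theorem exists_localInverse {q : Euc n → Euc n} (hq : ContDiff ℝ ∞ q)
    (h0 : (fderiv ℝ q 0).IsInvertible) :
    ∃ e : OpenPartialHomeomorph (Euc n) (Euc n), (e : Euc n → Euc n) = q ∧ 0 ∈ e.source ∧
      ContDiffOn ℝ ∞ e.symm e.target := by
  obtain ⟨A, hA⟩ := h0
  have hd : HasFDerivAt q (A : Euc n →L[ℝ] Euc n) 0 := by
    rw [hA]
    exact (hq.contDiffAt.differentiableAt (by simp)).hasFDerivAt
  let e₀ := (hq.contDiffAt (x := 0)).toOpenPartialHomeomorph q hd (by simp)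
  have hU : IsOpen {t | (fderiv ℝ q t).IsInvertible} :=
    ContinuousLinearEquiv.isOpen.preimage (hq.continuous_fderiv (by simp))
  refine ⟨e₀.restrOpen _ hU, rfl, ?_, ?_⟩
  · exact ⟨ContDiffAt.mem_toOpenPartialHomeomorph_source _ hd (by simp), ⟨A, hA⟩⟩
  · intro x hx
    refine ContDiffAt.contDiffWithinAt ?_
    obtain ⟨B, hB⟩ := ((e₀.restrOpen _ hU).map_target hx).2
    refine (e₀.restrOpen _ hU).contDiffAt_symm (f₀' := B) hx ?_ hq.contDiffAt
    rw [hB]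
    exact (hq.contDiffAt.differentiableAt (by simp)).hasFDerivAt

theorem exists_param {φ : OpenPartialHomeomorph M (Euc n)} (hφ : φ ∈ charts n M)
    {y : FrameModel n} (hy : y ∈ frameTarget φ) :
    ∃ f : LocalParam n M, f.toHomeo 0 = φ.symm y.1 ∧ f.toHomeo 0 ∈ φ.source ∧
      jet (φ ∘ f.toHomeo) = yToZ y := by
  have hi : (fderiv ℝ (quadMap y) 0).IsInvertible := by
    have h : fderiv ℝ (quadMap y) 0 = y.2.1 := congrArg (fun z => z.2.1) (jet_quadMap y)
    rw [h]
    exact hy.2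
  obtain ⟨e, he, h0, hs⟩ := exists_localInverse (contDiff_quadMap y) hi
  have hq0 : quadMap y 0 = y.1 := congrArg Prod.fst (jet_quadMap y)
  have hm : (0 : Euc n) ∈ (e.trans φ.symm).source := by
    simp [h0, he, hq0, hy.1]
  refine ⟨⟨e.trans φ.symm, hm, ?_, ?_⟩, ?_, ?_, ?_⟩
  · rw [OpenPartialHomeomorph.coe_trans]
    refine (contMDiffOn_symm_of_mem_maximalAtlas hφ).comp (t := φ.target) ?_ ?_
    · rw [he]
      exact (contDiff_quadMap y).contMDiff.contMDiffOn
    · intro x hx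
      exact hx.2
  · rw [OpenPartialHomeomorph.coe_trans_symm]
    refine (hs.contMDiffOn).comp (t := e.target) ?_ ?_
    · exact (contMDiffOn_of_mem_maximalAtlas hφ).mono (fun x hx => by simpa using hx.1)
    · intro x hx
      exact hx.2
  · simp [he, hq0]
  · simp [he, hq0, φ.map_target hy.1]
  · rw [← jet_quadMap]
    refine jet_congr ?_
    have ho := (e.trans φ.symm).open_source.mem_nhds hm
    filter_upwards [ho] with t ht
    have : quadMap y t ∈ φ.target := by simpa [he] using ht.2
    simp [he, φ.right_inv this]

theorem zCoord_eq {φ : OpenPartialHomeomorph M (Euc n)} (hφ : φ ∈ charts n M) {s : Frame₂ n M}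
    (hs : proj s ∈ φ.source) : zCoord φ s = yToZ (yCoord φ s) := by
  rw [← proj_out] at hs
  exact (yToZ_zToY (isInvertible_chart hφ _ hs) (symm_chart hφ _ hs)).symm

theorem bijOn_yCoord {φ : OpenPartialHomeomorph M (Euc n)} (hφ : φ ∈ charts n M) :
    BijOn (yCoord φ) (proj ⁻¹' φ.source) (frameTarget φ) := by
  refine ⟨?_, ?_, ?_⟩
  · intro s hs
    have hs' := hs
    rw [mem_preimage, ← proj_out] at hs'
    exact ⟨φ.map_source hs', isInvertible_chart hφ _ hs'⟩
  · intro s hs s' hs' h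
    have hz : zCoord φ s = zCoord φ s' := by rw [zCoord_eq hφ hs, zCoord_eq hφ hs', h]
    rw [mem_preimage, ← proj_out] at hs hs'
    rw [← j2_out s, ← j2_out s']
    have h0 : (Quotient.out s : LocalParam n M).toHomeo 0 =
        (Quotient.out s' : LocalParam n M).toHomeo 0 :=
      φ.injOn hs hs' (congrArg Prod.fst hz)
    refine Quotient.sound (s := jetSetoid n M) ⟨h0, fun ψ hψ hm => ?_⟩
    rw [jet_chart_change hφ hψ _ hs hm, jet_chart_change hφ hψ _ hs' (h0 ▸ hm)]
    exact congrArg _ hz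
  · intro y hy
    obtain ⟨f, -, hf, hj⟩ := exists_param hφ hy
    refine ⟨j2 f, hf, ?_⟩
    rw [yCoord, zCoord_j2 hφ f hf, hj, zToY_yToZ hy.2]

theorem nonempty_frame [IsManifold (𝓡 n) ∞ M] [Nonempty M] : Nonempty (Frame₂ n M) := by
  obtain ⟨x⟩ := ‹Nonempty M›
  have hφ : chartAt (Euc n) x ∈ charts n M := IsManifold.chart_mem_maximalAtlas x
  obtain ⟨f, -⟩ := exists_param hφ (y := (chartAt (Euc n) x x, ContinuousLinearMap.id ℝ _, 0))
    ⟨mem_chart_target _ x, ⟨ContinuousLinearEquiv.refl ℝ _, rfl⟩⟩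
  exact ⟨j2 f⟩

section Charts

variable [IsManifold (𝓡 n) ∞ M]

/-- The coordinates `y` as a bijection between the part of `S₂(M)` over the domain of a chart and
an open subset of the model space. -/
def frameEquiv (φ : OpenPartialHomeomorph M (Euc n)) (hφ : φ ∈ charts n M) :
    PartialEquiv (Frame₂ n M) (FrameModel n) :=
  haveI : Nonempty (Frame₂ n M) := haveI : Nonempty M := ⟨φ.symm 0⟩; nonempty_frame
  (bijOn_yCoord hφ).toPartialEquiv (yCoord φ) (proj ⁻¹' φ.source) (frameTarget φ)

theorem frameEquiv_coe (φ : OpenPartialHomeomorph M (Euc n)) (hφ : φ ∈ charts n M) :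
    (frameEquiv φ hφ : Frame₂ n M → FrameModel n) = yCoord φ := rfl

theorem frameEquiv_source (φ : OpenPartialHomeomorph M (Euc n)) (hφ : φ ∈ charts n M) :
    (frameEquiv φ hφ).source = proj ⁻¹' φ.source := rfl

theorem frameEquiv_target (φ : OpenPartialHomeomorph M (Euc n)) (hφ : φ ∈ charts n M) :
    (frameEquiv φ hφ).target = frameTarget φ := rfl

theorem proj_symm {φ : OpenPartialHomeomorph M (Euc n)} (hφ : φ ∈ charts n M)
    {y : FrameModel n} (hy : y ∈ frameTarget φ) : proj ((frameEquiv φ hφ).symm y) = φ.symm y.1 := by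
  have h1 := (frameEquiv φ hφ).map_target hy
  have h2 : yCoord φ ((frameEquiv φ hφ).symm y) = y := (frameEquiv φ hφ).right_inv hy
  have h3 : φ (proj ((frameEquiv φ hφ).symm y)) = y.1 := by
    rw [← proj_out]
    exact congrArg Prod.fst h2
  rw [← h3, φ.left_inv h1]

theorem transition_source {φ ψ : OpenPartialHomeomorph M (Euc n)} (hφ : φ ∈ charts n M)
    (hψ : ψ ∈ charts n M) : ((frameEquiv φ hφ).symm.trans (frameEquiv ψ hψ)).source =
      {y | y.1 ∈ (φ.symm.trans ψ).source ∧ y.2.1.IsInvertible} := by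
  ext y
  simp only [PartialEquiv.trans_source, PartialEquiv.symm_source, frameEquiv_target,
    frameEquiv_source, mem_inter_iff, mem_preimage, mem_ofPred_eq,
    OpenPartialHomeomorph.trans_source, OpenPartialHomeomorph.symm_source]
  constructor
  · rintro ⟨h1, h2⟩
    rw [proj_symm hφ h1] at h2
    exact ⟨⟨h1.1, h2⟩, h1.2⟩
  · rintro ⟨⟨h1, h2⟩, h3⟩
    refine ⟨⟨h1, h3⟩, ?_⟩
    rw [proj_symm hφ ⟨h1, h3⟩]
    exact h2

theorem transition_eq {φ ψ : OpenPartialHomeomorph M (Euc n)} (hφ : φ ∈ charts n M)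
    (hψ : ψ ∈ charts n M) : EqOn ((frameEquiv φ hφ).symm.trans (frameEquiv ψ hψ))
      (fun y => zToY (jetComp (ψ ∘ φ.symm) (yToZ y)))
      ((frameEquiv φ hφ).symm.trans (frameEquiv ψ hψ)).source := by
  intro y hy
  have hy1 : y ∈ frameTarget φ := hy.1
  have h1 : proj ((frameEquiv φ hφ).symm y) ∈ φ.source := (frameEquiv φ hφ).map_target hy.1
  have h2 : proj ((frameEquiv φ hφ).symm y) ∈ ψ.source := hy.2
  have h3 : yCoord φ ((frameEquiv φ hφ).symm y) = y := (frameEquiv φ hφ).right_inv hy1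
  have h4 := zCoord_eq hφ h1
  rw [h3] at h4
  change zToY (zCoord ψ ((frameEquiv φ hφ).symm y)) = _
  simp only [← h4]
  rw [← proj_out] at h1 h2
  exact congrArg zToY (jet_chart_change hφ hψ _ h1 h2)

theorem isOpen_transition_source {φ ψ : OpenPartialHomeomorph M (Euc n)} (hφ : φ ∈ charts n M)
    (hψ : ψ ∈ charts n M) : IsOpen ((frameEquiv φ hφ).symm.trans (frameEquiv ψ hψ)).source := by
  rw [transition_source]
  exact ((φ.symm.trans ψ).open_source.preimage continuous_fst).inter
    (ContinuousLinearEquiv.isOpen.preimage (continuous_fst.comp continuous_snd))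

theorem contDiffAt_contract {F : Type*} [NormedAddCommGroup F] [NormedSpace ℝ F]
    {a : F → Fin n → Fin n → Euc n} {L : F → Euc n →L[ℝ] Euc n} {x : F}
    (ha : ∀ p q, ContDiffAt ℝ ∞ (fun x => a x p q) x) (hL : ContDiffAt ℝ ∞ L x) (j k : Fin n) :
    ContDiffAt ℝ ∞ (fun x => contract (a x) (L x) j k) x := by
  have h : ∀ v : Euc n, ∀ p, ContDiffAt ℝ ∞ (fun x => L x v p) x := fun v p =>
    (contDiff_coord p).contDiffAt.comp x (hL.clm_apply contDiffAt_const)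
  exact ContDiffAt.sum fun p _ => ContDiffAt.sum fun q _ => ((h _ p).mul (h _ q)).smul (ha p q)

theorem contDiffAt_symArray {F : Type*} [NormedAddCommGroup F] [NormedSpace ℝ F]
    {a : F → Fin n → Fin n → Euc n} {x : F} (ha : ∀ p q, ContDiffAt ℝ ∞ (fun x => a x p q) x) :
    ContDiffAt ℝ ∞ (fun x => symArray (a x)) x := by
  rw [contDiffAt_pi]
  intro s
  induction s using Sym2.ind with
  | _ j k => exact ((ha j k).add (ha k j)).const_smul (2⁻¹ : ℝ)

theorem contDiffAt_partial₂ {h : Euc n → Euc n} {x : Euc n} (hh : ContDiffAt ℝ ∞ h x)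
    (p q : Fin n) : ContDiffAt ℝ ∞ (fun x => partial₂ h x p q) x :=
  (((hh.fderiv_right (m := ∞) (by norm_num)).clm_apply contDiffAt_const).fderiv_right (m := ∞)
    (by norm_num)).clm_apply contDiffAt_const

theorem contDiffOn_frame_transition {φ ψ : OpenPartialHomeomorph M (Euc n)}
    (hφ : φ ∈ charts n M) (hψ : ψ ∈ charts n M) :
    ContDiffOn ℝ ∞ ((frameEquiv φ hφ).symm.trans (frameEquiv ψ hψ))
      ((frameEquiv φ hφ).symm.trans (frameEquiv ψ hψ)).source := by
  refine ContDiffOn.congr ?_ (transition_eq hφ hψ)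
  intro y hy
  rw [transition_source] at hy
  refine ContDiffAt.contDiffWithinAt ?_
  have hh : ContDiffAt ℝ ∞ (ψ ∘ φ.symm) y.1 :=
    (contDiffOn_transition hφ hψ).contDiffAt ((φ.symm.trans ψ).open_source.mem_nhds hy.1)
  have h0 : ContDiffAt ℝ ∞ (fun y : FrameModel n => (ψ ∘ φ.symm) y.1) y :=
    hh.comp y contDiffAt_fst
  have h1 : ContDiffAt ℝ ∞ (fun y : FrameModel n => fderiv ℝ (ψ ∘ φ.symm) y.1) y :=
    (hh.fderiv_right (m := ∞) (by norm_num)).comp y contDiffAt_fst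
  have h2 : ∀ p q, ContDiffAt ℝ ∞ (fun y : FrameModel n => partial₂ (ψ ∘ φ.symm) y.1 p q) y :=
    fun p q => (contDiffAt_partial₂ hh p q).comp y contDiffAt_fst
  have hy1 : ContDiffAt ℝ ∞ (fun y : FrameModel n => y.2.1) y :=
    contDiffAt_fst.comp y contDiffAt_snd
  have hy2 : ∀ p q : Fin n, ContDiffAt ℝ ∞ (fun y : FrameModel n => y.2.2 s(p, q)) y :=
    fun p q => contDiffAt_pi.1 (contDiffAt_snd.comp y contDiffAt_snd) s(p, q)
  have g1 := h1.clm_comp hy1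
  have hinv : (fderiv ℝ (ψ ∘ φ.symm) y.1 ∘L y.2.1).IsInvertible := by
    have hy' := hy
    rw [← transition_source hφ hψ] at hy'
    have h5 := ((frameEquiv φ hφ).symm.trans (frameEquiv ψ hψ)).map_source hy'
    rw [transition_eq hφ hψ hy'] at h5
    have h6 := h5.1
    exact h6.2
  have g2 := (hinv.contDiffAt_map_inverse (n := ∞)).comp y g1
  have g3 : ∀ p q, ContDiffAt ℝ ∞ (fun y : FrameModel n =>
      (jetComp (ψ ∘ φ.symm) (yToZ y)).2.2 p q) y := fun p q =>
    (contDiffAt_contract h2 hy1 p q).add (h1.clm_apply (contDiffAt_contract hy2 hy1 p q))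
  exact h0.prodMk (g1.prodMk (contDiffAt_symArray (contDiffAt_contract g3 g2)))

variable (n M) in
/-- The atlas of `S₂(M)` consisting of the coordinates `y` for all smooth charts of `M`. -/
def frameCore : ChartedSpaceCore (FrameModel n) (Frame₂ n M) where
  atlas := {e | ∃ (φ : OpenPartialHomeomorph M (Euc n)) (hφ : φ ∈ charts n M), e = frameEquiv φ hφ}
  chartAt s := frameEquiv (chartAt (Euc n) (proj s)) (IsManifold.chart_mem_maximalAtlas (proj s))
  mem_chart_source s := mem_chart_source (Euc n) (proj s)
  chart_mem_atlas s := ⟨_, _, rfl⟩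
  open_source := by
    rintro _ _ ⟨φ, hφ, rfl⟩ ⟨ψ, hψ, rfl⟩
    exact isOpen_transition_source hφ hψ
  continuousOn_toFun := by
    rintro _ _ ⟨φ, hφ, rfl⟩ ⟨ψ, hψ, rfl⟩
    exact (contDiffOn_frame_transition hφ hψ).continuousOn

instance : TopologicalSpace (Frame₂ n M) := (frameCore n M).toTopologicalSpace

instance : ChartedSpace (FrameModel n) (Frame₂ n M) := (frameCore n M).toChartedSpace

/-- The chart `(yⁱ, yⁱⱼ, yⁱⱼₖ)` of `S₂(M)` induced by a smooth chart `φ` of `M`. -/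
def frameChart (φ : OpenPartialHomeomorph M (Euc n)) (hφ : φ ∈ charts n M) :
    OpenPartialHomeomorph (Frame₂ n M) (FrameModel n) :=
  (frameCore n M).openPartialHomeomorph (frameEquiv φ hφ) ⟨φ, hφ, rfl⟩

theorem mem_frame_atlas {e : OpenPartialHomeomorph (Frame₂ n M) (FrameModel n)} :
    e ∈ atlas (FrameModel n) (Frame₂ n M) ↔
      ∃ (φ : OpenPartialHomeomorph M (Euc n)) (hφ : φ ∈ charts n M), e = frameChart φ hφ := by
  change e ∈ (⋃ (e' : PartialEquiv (Frame₂ n M) (FrameModel n)) (he : e' ∈ (frameCore n M).atlas),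
    {(frameCore n M).openPartialHomeomorph e' he}) ↔ _
  simp only [mem_iUnion, mem_singleton_iff]
  constructor
  · rintro ⟨_, ⟨φ, hφ, rfl⟩, rfl⟩
    exact ⟨φ, hφ, rfl⟩
  · rintro ⟨φ, hφ, rfl⟩
    exact ⟨_, ⟨φ, hφ, rfl⟩, rfl⟩

instance : IsManifold 𝓘(ℝ, FrameModel n) ∞ (Frame₂ n M) := by
  refine isManifold_of_contDiffOn _ _ _ fun e e' he he' => ?_
  obtain ⟨φ, hφ, rfl⟩ := mem_frame_atlas.1 he
  obtain ⟨ψ, hψ, rfl⟩ := mem_frame_atlas.1 he'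
  simpa using! contDiffOn_frame_transition hφ hψ

/-- The composition `e ∘ f` of a parametrization at a point of the domain of a local diffeomorphism
`e` of `M` with `e`. -/
def LocalParam.push (f : LocalParam n M) (e : OpenPartialHomeomorph M M) (he : IsLocalDiffeo n e)
    (hf : f.toHomeo 0 ∈ e.source) : LocalParam n M where
  toHomeo := f.toHomeo.trans e
  zero_mem := by simp [f.zero_mem, hf]
  smooth := by
    rw [OpenPartialHomeomorph.coe_trans]
    exact he.1.comp (f.smooth.mono fun x hx => hx.1) fun x hx => hx.2
  smooth_symm := by
    rw [OpenPartialHomeomorph.coe_trans_symm]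
    exact f.smooth_symm.comp (he.2.mono fun x hx => hx.1) fun x hx => hx.2

open Classical in
/-- The action `j²f ↦ j²(e ∘ f)` of a local diffeomorphism `e` of `M` on `S₂(M)`, defined over the
domain of `e` (and extended by the identity to the rest of `S₂(M)`). -/
def prolong (e : OpenPartialHomeomorph M M) (s : Frame₂ n M) : Frame₂ n M :=
  if h : IsLocalDiffeo n e ∧ proj s ∈ e.source then
    j2 ((Quotient.out s : LocalParam n M).push e h.1 ((proj_out s).symm ▸ h.2))
  else s

/-- The action on two-jets does not depend on the representatives. -/
theorem prolong_j2 (e : OpenPartialHomeomorph M M) (he : IsLocalDiffeo n e) (f : LocalParam n M)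
    (hf : f.toHomeo 0 ∈ e.source) : prolong e (j2 f) = j2 (f.push e he hf) := by
  have h : (jetSetoid n M).r (Quotient.out (j2 f) : LocalParam n M) f := Quotient.mk_out f
  unfold prolong
  rw [dif_pos ⟨he, hf⟩]
  refine Quotient.sound (s := jetSetoid n M) ⟨congrArg e h.1, fun ψ hψ hm => ?_⟩
  have hc : e.trans ψ ∈ charts n M := by
    refine OpenPartialHomeomorph.mem_maximalAtlas_of_contMDiffOn _ ?_ ?_
    · rw [OpenPartialHomeomorph.coe_trans]
      exact (contMDiffOn_of_mem_maximalAtlas hψ).comp (he.1.mono fun x hx => hx.1)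
        fun x hx => hx.2
    · rw [OpenPartialHomeomorph.coe_trans_symm]
      exact he.2.comp ((contMDiffOn_symm_of_mem_maximalAtlas hψ).mono fun x hx => hx.1)
        fun x hx => hx.2
  exact h.2 (e.trans ψ) hc ⟨h.1.symm ▸ hf, hm⟩

end Charts

end FrameBundle

section Forms

/-- The wedge product of alternating forms, normalized by
`(α ∧ β)(v₁, …, v_r) = ∑ sign(σ) α(v_σ(1), …, v_σ(p)) β(v_σ(p+1), …, v_σ(r))`, where `σ` runs over
the `(p, q)`-shuffles. -/
def wedge {V : Type*} [AddCommGroup V] [Module ℝ V] [TopologicalSpace V] {p q r : ℕ}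
    (h : p + q = r) (α : V [⋀^Fin p]→L[ℝ] ℝ) (β : V [⋀^Fin q]→L[ℝ] ℝ) : V [⋀^Fin r]→L[ℝ] ℝ :=
  { ((LinearMap.mul' ℝ ℝ).compAlternatingMap
      (α.toAlternatingMap.domCoprod β.toAlternatingMap)).domDomCongr
        (finSumFinEquiv.trans (finCongr h)) with
    cont := by
      change Continuous fun v : Fin r → V => LinearMap.mul' ℝ ℝ
        ((α.toAlternatingMap.domCoprod β.toAlternatingMap)
          (v ∘ (finSumFinEquiv.trans (finCongr h))))
      simp only [AlternatingMap.domCoprod_apply, sum_apply, map_sum]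
      refine continuous_finsetSum _ fun σ _ => ?_
      induction σ using Quotient.inductionOn' with
      | _ σ =>
        have hc : Continuous fun v : Fin r → V =>
            α (fun i => v (finCongr h (finSumFinEquiv (σ (Sum.inl i))))) *
              β (fun i => v (finCongr h (finSumFinEquiv (σ (Sum.inr i))))) :=
          (α.cont.comp (continuous_pi fun i => continuous_apply _)).mul
            (β.cont.comp (continuous_pi fun i => continuous_apply _))
        simp only [AlternatingMap.domCoprod.summand_mk'', smul_apply,
          MultilinearMap.domDomCongr_apply, MultilinearMap.domCoprod_apply]
        rcases Int.units_eq_one_or (Equiv.Perm.sign σ) with hσ | hσ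
        · simp only [hσ, one_smul, LinearMap.mul'_apply]
          exact hc
        · simp only [hσ, Units.neg_smul, one_smul, map_neg, LinearMap.mul'_apply]
          exact hc.neg }

variable {F : Type*} [NormedAddCommGroup F] [NormedSpace ℝ F]
variable {N : Type*} [TopologicalSpace N] [ChartedSpace F N]

variable (F N) in
/-- The (not necessarily smooth) differential forms of degree `k` on a manifold `N`. -/
def DForm (k : ℕ) := (x : N) → (TangentSpace 𝓘(ℝ, F) x) [⋀^Fin k]→L[ℝ] ℝ

instance (k : ℕ) : AddCommGroup (DForm F N k) := Pi.addCommGroup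

instance (k : ℕ) : Module ℝ (DForm F N k) := Pi.module _ _ _

/-- The expression of a form in a chart: its pullback to the target of the chart. -/
def inChart {k : ℕ} (e : OpenPartialHomeomorph N F) (η : DForm F N k) (y : F) :
    F [⋀^Fin k]→L[ℝ] ℝ :=
  (η (e.symm y)).compContinuousLinearMap (mfderiv 𝓘(ℝ, F) 𝓘(ℝ, F) e.symm y)

/-- Smooth forms: smooth in all charts. -/
def IsSmoothForm {k : ℕ} (η : DForm F N k) : Prop :=
  ∀ e ∈ atlas F N, ContDiffOn ℝ ∞ (inChart e η) e.target

/-- The exterior derivative, computed at every point in the preferred chart at that point. -/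
def extD {k : ℕ} (η : DForm F N k) : DForm F N (k + 1) := fun x =>
  (extDeriv (inChart (chartAt F x) η) (chartAt F x x)).compContinuousLinearMap
    (mfderiv 𝓘(ℝ, F) 𝓘(ℝ, F) (chartAt F x) x)

/-- The power `β ∧ ⋯ ∧ β` (with `m` factors) of an alternating two-form. -/
def wedgePow {V : Type*} [AddCommGroup V] [Module ℝ V] [TopologicalSpace V]
    (β : V [⋀^Fin 2]→L[ℝ] ℝ) : (m : ℕ) → V [⋀^Fin (2 * m)]→L[ℝ] ℝ
  | 0 =>
    haveI : IsEmpty (Fin (2 * 0)) := Fin.isEmpty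
    ContinuousAlternatingMap.constOfIsEmpty ℝ V (Fin (2 * 0)) 1
  | m + 1 => wedge (Nat.mul_succ 2 m).symm (wedgePow β m) β

theorem inChart_add {k : ℕ} (e : OpenPartialHomeomorph N F) (α β : DForm F N k) :
    inChart e (α + β) = inChart e α + inChart e β := rfl

theorem inChart_smul {k : ℕ} (e : OpenPartialHomeomorph N F) (c : ℝ) (α : DForm F N k) :
    inChart e (c • α) = c • inChart e α := rfl

theorem inChart_zero {k : ℕ} (e : OpenPartialHomeomorph N F) :
    inChart e (0 : DForm F N k) = 0 := rfl

theorem IsSmoothForm.add {k : ℕ} {α β : DForm F N k} (hα : IsSmoothForm α)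
    (hβ : IsSmoothForm β) : IsSmoothForm (α + β) := fun e he => by
  rw [inChart_add]
  exact (hα e he).add (hβ e he)

theorem IsSmoothForm.smul {k : ℕ} {α : DForm F N k} (c : ℝ) (hα : IsSmoothForm α) :
    IsSmoothForm (c • α) := fun e he => by
  rw [inChart_smul]
  exact (hα e he).const_smul c

theorem isSmoothForm_zero {k : ℕ} : IsSmoothForm (0 : DForm F N k) := fun e _ => by
  rw [inChart_zero]
  exact contDiffOn_const

theorem IsSmoothForm.differentiableAt {k : ℕ} {α : DForm F N k} (hα : IsSmoothForm α) (x : N) :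
    DifferentiableAt ℝ (inChart (chartAt F x) α) (chartAt F x x) :=
  ((hα _ (chart_mem_atlas F x)).contDiffAt
    ((chartAt F x).open_target.mem_nhds (mem_chart_target F x))).differentiableAt (by simp)

theorem extD_add {k : ℕ} {α β : DForm F N k} (hα : IsSmoothForm α) (hβ : IsSmoothForm β) :
    extD (α + β) = extD α + extD β := by
  funext x
  unfold extD
  rw [inChart_add, extDeriv_add (hα.differentiableAt x) (hβ.differentiableAt x)]
  rfl

theorem extD_smul {k : ℕ} (c : ℝ) (α : DForm F N k) : extD (c • α) = c • extD α := by
  funext x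
  unfold extD
  rw [inChart_smul, extDeriv_smul]
  rfl

theorem extD_zero {k : ℕ} : extD (0 : DForm F N k) = 0 := by
  have h := extD_smul (0 : ℝ) (0 : DForm F N k)
  rwa [zero_smul, zero_smul] at h

end Forms

section Cohomology

variable {n : ℕ} {M : Type*} [TopologicalSpace M] [ChartedSpace (Euc n) M]
  [IsManifold (𝓡 n) ∞ M]

variable (n M) in
/-- Differential forms on the manifold `S₂(M)`. -/
abbrev FrameForm (k : ℕ) := DForm (FrameModel n) (Frame₂ n M) k

/-- Invariance of a form on `S₂(M)` under the action of a pseudogroup `P` of local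
diffeomorphisms of `M`. -/
def IsInvariant (P : StructureGroupoid M) {k : ℕ} (η : FrameForm n M k) : Prop :=
  ∀ e ∈ P, ∀ s : Frame₂ n M, proj s ∈ e.source →
    (η (prolong e s)).compContinuousLinearMap
      (mfderiv 𝓘(ℝ, FrameModel n) 𝓘(ℝ, FrameModel n) (prolong e) s) = η s

variable (n) in
/-- The space `Ωᵏ(S₂(M/P))`: smooth `P`-invariant forms on `S₂(M)`. -/
def invForms (P : StructureGroupoid M) (k : ℕ) : Submodule ℝ (FrameForm n M k) where
  carrier := {η | IsSmoothForm η ∧ IsInvariant P η}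
  add_mem' := by
    rintro α β ⟨h1, h2⟩ ⟨h3, h4⟩
    refine ⟨h1.add h3, fun e he s hs => ?_⟩
    exact congrArg₂ (· + ·) (h2 e he s hs) (h4 e he s hs)
  zero_mem' := ⟨isSmoothForm_zero, fun _ _ _ _ => rfl⟩
  smul_mem' := by
    rintro c α ⟨h1, h2⟩
    refine ⟨h1.smul c, fun e he s hs => ?_⟩
    exact congrArg (c • ·) (h2 e he s hs)

variable (n) in
/-- The closed forms in `Ωᵏ(S₂(M/P))`. -/
def closedForms (P : StructureGroupoid M) (k : ℕ) : Submodule ℝ (FrameForm n M k) where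
  carrier := {η | η ∈ invForms n P k ∧ extD η = 0}
  add_mem' := by
    rintro α β ⟨h1, h2⟩ ⟨h3, h4⟩
    exact ⟨add_mem h1 h3, by rw [extD_add h1.1 h3.1, h2, h4, add_zero]⟩
  zero_mem' := ⟨zero_mem _, extD_zero⟩
  smul_mem' := by
    rintro c α ⟨h1, h2⟩
    exact ⟨Submodule.smul_mem _ c h1, by rw [extD_smul, h2, smul_zero]⟩

variable (n) in
/-- The exact forms in `Ωᵏ(S₂(M/P))`: differentials of forms in `Ωᵏ⁻¹(S₂(M/P))`. -/
def exactForms (P : StructureGroupoid M) : (k : ℕ) → Submodule ℝ (FrameForm n M k)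
  | 0 => ⊥
  | k + 1 =>
    { carrier := {η | ∃ α ∈ invForms n P k, extD α = η}
      add_mem' := by
        rintro _ _ ⟨α, h1, rfl⟩ ⟨β, h2, rfl⟩
        exact ⟨α + β, add_mem h1 h2, extD_add h1.1 h2.1⟩
      zero_mem' := ⟨0, zero_mem _, extD_zero⟩
      smul_mem' := by
        rintro c _ ⟨α, h1, rfl⟩
        exact ⟨c • α, Submodule.smul_mem _ c h1, extD_smul c α⟩ }

variable (n) in
/-- The de Rham cohomology `Hᵏ(S₂(M/P))`: closed forms modulo exact forms. -/
abbrev Cohomology (P : StructureGroupoid M) (k : ℕ) :=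
  closedForms n P k ⧸ (exactForms n P k).comap (closedForms n P k).subtype

variable (n) in
/-- The cohomology class of a closed form. -/
def cohomologyClass (P : StructureGroupoid M) {k : ℕ} (η : FrameForm n M k)
    (h : η ∈ closedForms n P k) : Cohomology n P k :=
  Submodule.Quotient.mk ⟨η, h⟩

/-- A family `k_u`, `u ∈ ℝ`, of parametrizations, smooth in `(u, t)` near `(0, 0)`. -/
def IsSmoothFamily (k : ℝ → LocalParam n M) : Prop :=
  ∃ W ∈ 𝓝 ((0, 0) : ℝ × Euc n),
    ContMDiffOn 𝓘(ℝ, ℝ × Euc n) (𝓡 n) ∞ (fun p : ℝ × Euc n => (k p.1).toHomeo p.2) W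

/-- The vector field `-d/du (k₀⁻¹ ∘ k_u)|_{u = 0}` near `0 ∈ ℝⁿ`; its jet at `0` is the value of the
canonical Gelfand-Kazhdan form on the velocity vector of the curve of jets of `k_u`. -/
def gelfandKazhdanField (k : ℝ → LocalParam n M) (t : Euc n) : Euc n :=
  -deriv (fun u : ℝ => (k 0).toHomeo.symm ((k u).toHomeo t)) 0

/-- The one-cochain `cⁱⱼ(ξ) = ∂ξⁱ/∂xʲ(0)` on vector fields near `0 ∈ ℝⁿ`. -/
def cochain₁ (i j : Fin n) (ξ : Euc n → Euc n) : ℝ := fderiv ℝ ξ 0 (stdVec j) i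

/-- `Γ` is the one-form `Γ₁ = θⁱᵢ` on `S₂(M)`, where `θⁱⱼ` is obtained by applying the cochain `cⁱⱼ` to
the canonical Gelfand-Kazhdan form: on the velocity vector at `u = 0` of the curve `u ↦ j²k_u` it
takes the value `∑ᵢ cⁱᵢ(-d/du (k₀⁻¹ ∘ k_u)|_{u = 0})`. -/
def IsGammaOne (Γ : FrameForm n M 1) : Prop :=
  ∀ k : ℝ → LocalParam n M, IsSmoothFamily k →
    Γ (j2 (k 0)) (fun _ => mfderiv 𝓘(ℝ, ℝ) 𝓘(ℝ, FrameModel n) (fun u => j2 (k u)) 0 (1 : ℝ)) =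
      ∑ i, cochain₁ i i (gelfandKazhdanField k)

/-- The form `Γ ∧ (dΓ)ⁿ` of degree `2n + 1` for a one-form `Γ` on `S₂(M)`. -/
def gvlForm (Γ : FrameForm n M 1) : FrameForm n M (2 * n + 1) := fun s =>
  wedge (Nat.add_comm 1 (2 * n)) (Γ s) (wedgePow (extD Γ s) n)

end Cohomology

section Coordinates

variable {n : ℕ}

/-- The coordinate one-form `dyⁱ`. -/
def dy (i : Fin n) : FrameModel n →L[ℝ] ℝ :=
  (EuclideanSpace.proj i).comp (ContinuousLinearMap.fst ℝ _ _)

/-- The coordinate one-form `dyⁱⱼ`. -/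
def dy₁ (i j : Fin n) : FrameModel n →L[ℝ] ℝ :=
  (EuclideanSpace.proj i).comp ((ContinuousLinearMap.apply ℝ (Euc n) (stdVec j)).comp
    ((ContinuousLinearMap.fst ℝ _ _).comp (ContinuousLinearMap.snd ℝ _ _)))

/-- The coordinate one-form `dyⁱⱼₖ`. -/
def dy₂ (i j k : Fin n) : FrameModel n →L[ℝ] ℝ :=
  (EuclideanSpace.proj i).comp ((ContinuousLinearMap.proj s(j, k)).comp
    ((ContinuousLinearMap.snd ℝ _ _).comp (ContinuousLinearMap.snd ℝ _ _)))

/-- A covector as an alternating form of degree one. -/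
def toForm (a : FrameModel n →L[ℝ] ℝ) : FrameModel n [⋀^Fin 1]→L[ℝ] ℝ :=
  ContinuousAlternatingMap.ofSubsingleton ℝ (FrameModel n) ℝ 0 a

/-- The matrix `(yⁱⱼ)`. -/
def frameMatrix (y : FrameModel n) : Matrix (Fin n) (Fin n) ℝ :=
  Matrix.of fun i j => y.2.1 (stdVec j) i

/-- The form `-vʲᵢ dyⁱⱼ ∧ (dyᵏₖₗ ∧ dyˡ)ⁿ`, where `v` is the inverse of the matrix `(yⁱⱼ)`. -/
def coordForm (y : FrameModel n) : FrameModel n [⋀^Fin (2 * n + 1)]→L[ℝ] ℝ :=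
  wedge (Nat.add_comm 1 (2 * n))
    (-∑ i, ∑ j, (frameMatrix y)⁻¹ j i • toForm (dy₁ i j))
    (wedgePow (∑ k, ∑ l, wedge rfl (toForm (dy₂ k k l)) (toForm (dy l))) n)

end Coordinates

end Losik

end

open scoped Manifold ContDiff

noncomputable section

namespace Losik

open Set Filter Function
open scoped Topology

/-! ### Algebra of wedge products: naturality, expansion along a covector, vanishing by counting
arguments. -/

section WedgeAlgebra

variable {V W : Type*} [AddCommGroup V] [Module ℝ V] [TopologicalSpace V]
  [AddCommGroup W] [Module ℝ W] [TopologicalSpace W]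

/-! In the coordinates induced by any chart, `Γ₁` is the form γ = -vʲᵢ dyⁱⱼ + yᵏₖₗ dyˡ
(`gammaCoord`). To see this, read a family k_u in the chart as G(u, t). The field ξ satisfies
(∂G/∂t) ξ = -∂G/∂u; differentiating this identity in t at 0, applying (∂G/∂t)⁻¹ and taking the trace
expresses div ξ(0) through the velocity of the curve of jets, and the result is γ on that velocity
(`gammaCoord_deriv_jetCurve`). Every tangent vector of S₂(M) is such a velocity
(`exists_velocity_eq`), so the prescription determines the form, and γ is its expression in all
charts at once (`IsGammaOne.hasCoordFormula`); no transformation law for γ has to be computed.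

A form with one and the same expression in all induced charts is invariant under every local
diffeomorphism e: composing a chart ψ with e gives another chart, and between the coordinates
induced by ψ ∘ e and by ψ the action of e is the identity (`HasCoordFormula.isInvariant`). Such a
form is smooth if its expression is, and its exterior derivative again has a uniform expression
(`HasCoordFormula.extD`).

The rest is algebra in the model space. The term vʲᵢ dyⁱⱼ = tr(Y⁻¹ dY), with Y = (yⁱⱼ), is the
differential of log |det Y|, hence closed; so dγ is the constant form ω = dyᵏₖₗ ∧ dyˡ
(`extDeriv_gammaCoord`). In γ ∧ ωⁿ the term yᵏₖₗ dyˡ would give n + 1 factors among the n covectors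
dyˡ, and it drops out (`wedge_gammaCoord`). Thus Γ₁ ∧ (dΓ₁)ⁿ is equal, not merely cohomologous, to
the form -vʲᵢ dyⁱⱼ ∧ ωⁿ. This is a closed one-form times a constant form, so it is closed
(`extDeriv_coordForm`). -/

/-- The contribution of a class of permutations to a wedge product. -/
def wedgeTerm {p q : ℕ} (α : V [⋀^Fin p]→L[ℝ] ℝ) (β : V [⋀^Fin q]→L[ℝ] ℝ)
    (σ : Equiv.Perm.ModSumCongr (Fin p) (Fin q)) (w : Fin p ⊕ Fin q → V) : ℝ :=
  LinearMap.mul' ℝ ℝ (AlternatingMap.domCoprod.summand α.toAlternatingMap β.toAlternatingMap σ w)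

theorem wedgeTerm_mk {p q : ℕ} (α : V [⋀^Fin p]→L[ℝ] ℝ) (β : V [⋀^Fin q]→L[ℝ] ℝ)
    (σ : Equiv.Perm (Fin p ⊕ Fin q)) (w : Fin p ⊕ Fin q → V) :
    wedgeTerm α β (Quotient.mk'' σ) w =
      ((Equiv.Perm.sign σ : ℤ) : ℝ) *
        (α (fun i => w (σ (Sum.inl i))) * β (fun i => w (σ (Sum.inr i)))) := by
  unfold wedgeTerm
  rw [AlternatingMap.domCoprod.summand_mk'']
  rcases Int.units_eq_one_or (Equiv.Perm.sign σ) with hσ | hσ <;> simp [hσ]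

theorem wedge_apply {p q r : ℕ} (h : p + q = r) (α : V [⋀^Fin p]→L[ℝ] ℝ)
    (β : V [⋀^Fin q]→L[ℝ] ℝ) (v : Fin r → V) :
    wedge h α β v = ∑ σ, wedgeTerm α β σ (v ∘ (finSumFinEquiv.trans (finCongr h))) := by
  change LinearMap.mul' ℝ ℝ ((α.toAlternatingMap.domCoprod β.toAlternatingMap)
      (v ∘ (finSumFinEquiv.trans (finCongr h)))) = _
  rw [AlternatingMap.domCoprod_apply, sum_apply, map_sum]
  rfl

theorem wedge_comp {p q r : ℕ} (h : p + q = r) (α : V [⋀^Fin p]→L[ℝ] ℝ)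
    (β : V [⋀^Fin q]→L[ℝ] ℝ) (L : W →L[ℝ] V) :
    (wedge h α β).compContinuousLinearMap L =
      wedge h (α.compContinuousLinearMap L) (β.compContinuousLinearMap L) := by
  ext v
  rw [ContinuousAlternatingMap.compContinuousLinearMap_apply, wedge_apply, wedge_apply]
  refine Finset.sum_congr rfl fun σ _ => ?_
  induction σ using Quotient.inductionOn' with
  | _ σ =>
    rw [wedgeTerm_mk, wedgeTerm_mk]
    rfl

theorem wedgePow_comp (β : V [⋀^Fin 2]→L[ℝ] ℝ) (L : W →L[ℝ] V) (m : ℕ) :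
    (wedgePow β m).compContinuousLinearMap L = wedgePow (β.compContinuousLinearMap L) m := by
  induction m with
  | zero => rfl
  | succ m ih => rw [wedgePow, wedge_comp, ih, wedgePow]

theorem wedge_add_left {p q r : ℕ} (h : p + q = r) [ContinuousAdd V] (α α' : V [⋀^Fin p]→L[ℝ] ℝ)
    (β : V [⋀^Fin q]→L[ℝ] ℝ) : wedge h (α + α') β = wedge h α β + wedge h α' β := by
  ext v
  rw [ContinuousAlternatingMap.add_apply, wedge_apply, wedge_apply, wedge_apply,
    ← Finset.sum_add_distrib]
  refine Finset.sum_congr rfl fun σ _ => ?_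
  induction σ using Quotient.inductionOn' with
  | _ σ =>
    rw [wedgeTerm_mk, wedgeTerm_mk, wedgeTerm_mk, ContinuousAlternatingMap.add_apply]
    ring

/-- A cyclic permutation moving the summand `Fin 1` to position `p`. -/
def insertPerm {q : ℕ} (p : Fin (q + 1)) : Equiv.Perm (Fin 1 ⊕ Fin q) :=
  (finSumFinEquiv.trans (finCongr (Nat.add_comm 1 q))).permCongr.symm p.cycleRange.symm

theorem finSum_inl {q : ℕ} (i : Fin 1) :
    (finSumFinEquiv.trans (finCongr (Nat.add_comm 1 q))) (Sum.inl i) = 0 := by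
  ext
  simp

theorem finSum_inr {q : ℕ} (i : Fin q) :
    (finSumFinEquiv.trans (finCongr (Nat.add_comm 1 q))) (Sum.inr i) = i.succ := by
  ext
  simp

theorem insertPerm_inl {q : ℕ} (p : Fin (q + 1)) (i : Fin 1) :
    (finSumFinEquiv.trans (finCongr (Nat.add_comm 1 q))) (insertPerm p (Sum.inl i)) = p := by
  rw [insertPerm, Equiv.permCongr_symm_apply, finSum_inl, Equiv.apply_symm_apply,
    Fin.cycleRange_symm_zero]

theorem insertPerm_inr {q : ℕ} (p : Fin (q + 1)) (i : Fin q) :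
    (finSumFinEquiv.trans (finCongr (Nat.add_comm 1 q))) (insertPerm p (Sum.inr i)) =
      p.succAbove i := by
  rw [insertPerm, Equiv.permCongr_symm_apply, finSum_inr, Equiv.apply_symm_apply,
    Fin.cycleRange_symm_succ]

theorem sign_insertPerm {q : ℕ} (p : Fin (q + 1)) :
    Equiv.Perm.sign (insertPerm p) = (-1) ^ (p : ℕ) := by
  rw [insertPerm, ← Equiv.Perm.sign_permCongr
    (finSumFinEquiv.trans (finCongr (Nat.add_comm 1 q))), Equiv.apply_symm_apply,
    Equiv.Perm.sign_symm, Fin.sign_cycleRange]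

/-- Modulo permutations within the two summands, a permutation of `Fin 1 ⊕ Fin q` is determined by
the image of the single left element. The cycles `insertPerm p` are therefore a full set of
shuffles. -/
theorem bijective_insertPerm {q : ℕ} : Bijective (fun p : Fin (q + 1) =>
    (Quotient.mk'' (insertPerm p) : Equiv.Perm.ModSumCongr (Fin 1) (Fin q))) := by
  constructor
  · intro p p' h
    obtain ⟨⟨a, b⟩, hs⟩ := QuotientGroup.leftRel_apply.mp (Quotient.exact' h)
    have h1 := (inv_mul_eq_iff_eq_mul.mp hs.symm)
    have h2 := insertPerm_inl p' 0
    rw [h1, Equiv.Perm.mul_apply] at h2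
    have h3 : (Equiv.Perm.sumCongrHom (Fin 1) (Fin q) (a, b)) (Sum.inl 0) = Sum.inl 0 :=
      congrArg Sum.inl (Subsingleton.elim _ _)
    rw [h3, insertPerm_inl] at h2
    exact h2
  · intro σ
    induction σ using Quotient.inductionOn' with
    | _ σ =>
      refine ⟨(finSumFinEquiv.trans (finCongr (Nat.add_comm 1 q))) (σ (Sum.inl 0)), ?_⟩
      refine Quotient.sound' (QuotientGroup.leftRel_apply.mpr ?_)
      refine Equiv.Perm.mem_sumCongrHom_range_of_perm_mapsTo_inl ?_
      rintro _ ⟨i, rfl⟩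
      refine ⟨0, ?_⟩
      rw [Equiv.Perm.mul_apply, Equiv.Perm.eq_inv_iff_eq]
      apply (finSumFinEquiv.trans (finCongr (Nat.add_comm 1 q))).injective
      rw [insertPerm_inl, Subsingleton.elim i 0]

/-- The (1, q)-shuffles are indexed by the position `i` of the argument given to `a`, with sign
(-1)ⁱ. This is the same signed sum as in the exterior derivative, which is how `wedge` gets
connected with `extDeriv`. -/
theorem wedge_ofSubsingleton_apply {q : ℕ} (a : V →L[ℝ] ℝ) (β : V [⋀^Fin q]→L[ℝ] ℝ)
    (v : Fin (q + 1) → V) :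
    wedge (Nat.add_comm 1 q) (ContinuousAlternatingMap.ofSubsingleton ℝ V ℝ 0 a) β v =
      ∑ i : Fin (q + 1), (-1) ^ (i : ℕ) * (a (v i) * β (i.removeNth v)) := by
  rw [wedge_apply]
  refine (Fintype.sum_bijective _ bijective_insertPerm _ _ fun p => Eq.symm ?_).symm
  rw [wedgeTerm_mk, sign_insertPerm]
  congr 1
  · simp
  · refine congrArg₂ (· * ·) ?_ ?_
    · rw [ContinuousAlternatingMap.ofSubsingleton_apply_apply]
      exact congrArg a (congrArg v (insertPerm_inl p 0))
    · refine congrArg β (funext fun i => ?_)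
      exact congrArg v (insertPerm_inr p i)

/-- `IsFiltered K m η`: the form `η` vanishes as soon as fewer than `m` of its arguments lie
outside of `K`. -/
def IsFiltered (K : Set V) (m : ℕ) {r : ℕ} (η : V [⋀^Fin r]→L[ℝ] ℝ) : Prop :=
  ∀ v : Fin r → V, {i | v i ∉ K}.ncard < m → η v = 0

/-- In each term the arguments are split between `α` and `β`. If fewer than `m + m'` of them lie
outside `K`, then `α` receives fewer than `m` of these or `β` fewer than `m'`, and that factor
vanishes. -/
theorem IsFiltered.wedge {K : Set V} {m m' p q r : ℕ} (h : p + q = r)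
    {α : V [⋀^Fin p]→L[ℝ] ℝ} {β : V [⋀^Fin q]→L[ℝ] ℝ} (hα : IsFiltered K m α)
    (hβ : IsFiltered K m' β) : IsFiltered K (m + m') (wedge h α β) := by
  intro v hv
  rw [wedge_apply]
  refine Finset.sum_eq_zero fun σ _ => ?_
  induction σ using Quotient.inductionOn' with
  | _ σ =>
    rw [wedgeTerm_mk]
    set w := v ∘ (finSumFinEquiv.trans (finCongr h)) with hw
    set a : Set (Fin p) := {i | w (σ (Sum.inl i)) ∉ K} with ha
    set b : Set (Fin q) := {i | w (σ (Sum.inr i)) ∉ K} with hb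
    have hab : a.ncard + b.ncard ≤ {i | v i ∉ K}.ncard := by
      have e1 : (Sum.inl '' a ∪ Sum.inr '' b : Set (Fin p ⊕ Fin q)).ncard = a.ncard + b.ncard := by
        rw [Set.ncard_union_eq (by
          rw [Set.disjoint_left]; rintro _ ⟨x, _, rfl⟩ ⟨y, _, hy⟩; cases hy),
          Set.ncard_image_of_injective _ Sum.inl_injective,
          Set.ncard_image_of_injective _ Sum.inr_injective]
      rw [← e1]
      refine Set.ncard_le_ncard_of_injOn
        (fun i => (finSumFinEquiv.trans (finCongr h)) (σ i)) ?_
        ((Equiv.injective _).comp σ.injective).injOn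
      rintro _ (⟨i, hi, rfl⟩ | ⟨i, hi, rfl⟩)
      · exact hi
      · exact hi
    rcases lt_or_ge a.ncard m with h1 | h1
    · rw [hα _ h1]; ring
    · rw [hβ _ (show b.ncard < m' by omega)]; ring

theorem IsFiltered.wedgePow {K : Set V} {β : V [⋀^Fin 2]→L[ℝ] ℝ} (hβ : IsFiltered K 1 β) (m : ℕ) :
    IsFiltered K m (wedgePow β m) := by
  induction m with
  | zero => exact fun v hv => absurd hv (Nat.not_lt_zero _)
  | succ m ih => exact ih.wedge _ hβ

/-- An alternating form is determined by its values on tuples of distinct basis vectors, and such a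
tuple contains at most `Fintype.card ι` vectors outside `K`. -/
theorem IsFiltered.eq_zero {ι κ : Type*} [Fintype ι] (b : Module.Basis (ι ⊕ κ) ℝ V)
    {K : Set V} (hb : ∀ k, b (Sum.inr k) ∈ K) {m r : ℕ} (hm : Fintype.card ι < m)
    {η : V [⋀^Fin r]→L[ℝ] ℝ} (hη : IsFiltered K m η) : η = 0 := by
  refine ContinuousAlternatingMap.toAlternatingMap_injective ?_
  refine Module.Basis.ext_alternating b fun v hv => ?_
  refine hη _ (lt_of_le_of_lt ?_ hm)
  calc {i | b (v i) ∉ K}.ncard ≤ (Set.range (Sum.inl : ι → ι ⊕ κ)).ncard := by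
        refine Set.ncard_le_ncard_of_injOn v ?_ hv.injOn (Set.finite_range _)
        intro i hi
        rcases h : v i with x | x
        · exact ⟨x, rfl⟩
        · exact absurd (hb x) (h ▸ hi)
    _ = Fintype.card ι := by
        rw [← Set.image_univ, Set.ncard_image_of_injective _ Sum.inl_injective, Set.ncard_univ,
          Nat.card_eq_fintype_card]

end WedgeAlgebra

/-! ### The forms γ, ω and γ ∧ ωⁿ on the model space. -/

section CoordinateForms

/-- The wedge product of a covector with a fixed form, as a linear map of the covector. -/
def wedgeLeftL {E : Type*} [NormedAddCommGroup E] [NormedSpace ℝ E] {q : ℕ}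
    (β : E [⋀^Fin q]→L[ℝ] ℝ) : (E →L[ℝ] ℝ) →L[ℝ] E [⋀^Fin (q + 1)]→L[ℝ] ℝ :=
  (ContinuousAlternatingMap.alternatizeUncurryFinCLM ℝ E ℝ).comp
    ((ContinuousLinearMap.smulRightL ℝ E _).flip β)

/-- Alternatizing `a ⊗ β` over the inserted index carries no factorials, so it agrees with the
shuffle normalization of `wedge`. The gain is a continuous linear dependence on `a`, through which
derivatives pass. -/
theorem wedgeLeftL_apply {E : Type*} [NormedAddCommGroup E] [NormedSpace ℝ E] {q : ℕ}
    (β : E [⋀^Fin q]→L[ℝ] ℝ) (a : E →L[ℝ] ℝ) :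
    wedgeLeftL β a =
      wedge (Nat.add_comm 1 q) (ContinuousAlternatingMap.ofSubsingleton ℝ E ℝ 0 a) β := by
  ext v
  rw [wedge_ofSubsingleton_apply]
  change ContinuousAlternatingMap.alternatizeUncurryFin (a.smulRight β) v = _
  rw [ContinuousAlternatingMap.alternatizeUncurryFin_apply]
  simp

/-- A one-form with symmetric derivative is closed, and so is its product with a constant form. -/
theorem extDeriv_wedgeLeftL {E : Type*} [NormedAddCommGroup E] [NormedSpace ℝ E] {q : ℕ}
    (β : E [⋀^Fin q]→L[ℝ] ℝ) {a : E → E →L[ℝ] ℝ} {D : E →L[ℝ] E →L[ℝ] ℝ} {x : E}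
    (ha : HasFDerivAt a D x) (hD : ∀ u w, D u w = D w u) :
    extDeriv (fun x => wedgeLeftL β (a x)) x = 0 := by
  have h : HasFDerivAt (fun x => wedgeLeftL β (a x)) ((wedgeLeftL β).comp D) x :=
    (wedgeLeftL β).hasFDerivAt.comp x ha
  rw [extDeriv, h.fderiv, wedgeLeftL, ContinuousLinearMap.comp_assoc]
  -- The algebra behind d ∘ d = 0: alternatizing twice kills whatever is symmetric in the two
  -- inserted arguments.
  refine ContinuousAlternatingMap.alternatizeUncurryFin_alternatizeUncurryFinCLM_comp_of_symmetric
    fun u w => ?_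
  change D u w • β = D w u • β
  rw [hD]

variable {n : ℕ}

instance covectorNormedAddCommGroup : NormedAddCommGroup (FrameModel n →L[ℝ] ℝ) :=
  ContinuousLinearMap.toNormedAddCommGroup

instance covectorNormedSpace : NormedSpace ℝ (FrameModel n →L[ℝ] ℝ) :=
  ContinuousLinearMap.toNormedSpace

instance formNormedAddCommGroup (k : ℕ) : NormedAddCommGroup (FrameModel n [⋀^Fin k]→L[ℝ] ℝ) :=
  ContinuousAlternatingMap.instNormedAddCommGroup

instance formNormedSpace (k : ℕ) : NormedSpace ℝ (FrameModel n [⋀^Fin k]→L[ℝ] ℝ) :=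
  ContinuousAlternatingMap.instNormedSpace

variable (n) in
/-- The projection `y ↦ (yⁱⱼ)`. -/
def linearPart : FrameModel n →L[ℝ] Euc n →L[ℝ] Euc n :=
  (ContinuousLinearMap.fst ℝ _ _).comp (ContinuousLinearMap.snd ℝ _ _)

variable (n) in
/-- The points of the model space with invertible matrix `(yⁱⱼ)`. -/
def frameDomain : Set (FrameModel n) := {y | y.2.1.IsInvertible}

theorem isOpen_frameDomain : IsOpen (frameDomain n) :=
  ContinuousLinearEquiv.isOpen.preimage (continuous_fst.comp continuous_snd)

/-- The covector `vʲᵢ dyⁱⱼ`. -/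
def logDetCovector (y : FrameModel n) : FrameModel n →L[ℝ] ℝ :=
  ∑ i, ∑ j, (frameMatrix y)⁻¹ j i • dy₁ i j

/-- The covector `yᵏₖₗ dyˡ`. -/
def contractCovector (y : FrameModel n) : FrameModel n →L[ℝ] ℝ :=
  ∑ k, ∑ l, y.2.2 s(k, l) k • dy l

/-- The form `-vʲᵢ dyⁱⱼ + yᵏₖₗ dyˡ`. -/
def gammaCoord (y : FrameModel n) : FrameModel n [⋀^Fin 1]→L[ℝ] ℝ :=
  toForm (-logDetCovector y + contractCovector y)

variable (n) in
/-- The form `dyᵏₖₗ ∧ dyˡ`. -/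
def omegaCoord : FrameModel n [⋀^Fin 2]→L[ℝ] ℝ :=
  ∑ k, ∑ l, wedge rfl (toForm (dy₂ k k l)) (toForm (dy l))

/-- Passes from the matrix inverse in the stated formula to the inverse operator, whose derivative
is available without coordinates. -/
theorem inv_frameMatrix {y : FrameModel n} (hy : y ∈ frameDomain n) (i j : Fin n) :
    (frameMatrix y)⁻¹ j i = y.2.1.inverse (stdVec i) j := by
  have h : (Matrix.of fun j i => y.2.1.inverse (stdVec i) j) * frameMatrix y = 1 := by
    ext j k
    have h2 := congrArg (fun x : Euc n => x j)
      (map_sum_stdVec y.2.1.inverse (y.2.1 (stdVec k)))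
    simp only [hy.inverse_apply_self, PiLp.single_apply] at h2
    rw [Matrix.mul_apply, Matrix.one_apply, ← h2]
    simp [frameMatrix, mul_comm]
  rw [Matrix.inv_eq_left_inv h]
  rfl

variable (n) in
/-- The covectors `w ↦ tr (A (wⁱⱼ))`, linear in `A`. -/
def traceCovectorL : (Euc n →L[ℝ] Euc n) →L[ℝ] FrameModel n →L[ℝ] ℝ :=
  ∑ j, (ContinuousLinearMap.compL ℝ (FrameModel n) (Euc n) ℝ
      (EuclideanSpace.proj (𝕜 := ℝ) j)).comp
    ((ContinuousLinearMap.compL ℝ (FrameModel n) (Euc n) (Euc n)).flip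
      ((ContinuousLinearMap.apply ℝ (Euc n) (stdVec j)).comp (linearPart n)))

theorem traceCovectorL_apply (A : Euc n →L[ℝ] Euc n) (w : FrameModel n) :
    traceCovectorL n A w = ∑ j, A (w.2.1 (stdVec j)) j := by
  simp [traceCovectorL, linearPart]

/-- This is tr(Y⁻¹ dY), a fixed linear function of Y⁻¹; smoothness and the derivative are thereby
reduced to those of operator inversion. -/
theorem logDetCovector_eq {y : FrameModel n} (hy : y ∈ frameDomain n) :
    logDetCovector y = traceCovectorL n y.2.1.inverse := by
  refine ContinuousLinearMap.ext fun w => ?_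
  have h (j : Fin n) : y.2.1.inverse (w.2.1 (stdVec j)) j =
      ∑ i, y.2.1.inverse (stdVec i) j * w.2.1 (stdVec j) i := by
    conv_lhs => rw [← map_sum_stdVec y.2.1.inverse (w.2.1 (stdVec j))]
    simp [mul_comm]
  rw [traceCovectorL_apply]
  simp only [logDetCovector, sum_apply, smul_apply, inv_frameMatrix hy, h, smul_eq_mul]
  exact Finset.sum_comm

theorem sum_comp_comm (A B : Euc n →L[ℝ] Euc n) :
    ∑ j, A (B (stdVec j)) j = ∑ j, B (A (stdVec j)) j := by
  have h (A B : Euc n →L[ℝ] Euc n) (j : Fin n) :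
      A (B (stdVec j)) j = ∑ k, B (stdVec j) k * A (stdVec k) j := by
    conv_lhs => rw [← map_sum_stdVec A (B (stdVec j))]
    simp
  simp only [h]
  rw [Finset.sum_comm]
  simp only [mul_comm]

/-- Invertible operators are the units of a complete normed ring, where inversion has derivative u ↦
-L⁻¹ u L⁻¹. -/
theorem hasFDerivAt_inverse {L : Euc n →L[ℝ] Euc n} (hL : L.IsInvertible) :
    ∃ D : (Euc n →L[ℝ] Euc n) →L[ℝ] Euc n →L[ℝ] Euc n,
      HasFDerivAt ContinuousLinearMap.inverse D L ∧
        ∀ u, D u = -(L.inverse.comp (u.comp L.inverse)) := by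
  obtain ⟨e, rfl⟩ := hL
  have h := hasFDerivAt_ringInverse (𝕜 := ℝ) ((ContinuousLinearEquiv.unitsEquiv ℝ (Euc n)).symm e)
  rw [ContinuousLinearMap.ringInverse_eq_inverse] at h
  refine ⟨_, h, fun u => ?_⟩
  rw [ContinuousLinearMap.inverse_equiv]
  rfl

/-- The derivative is (u, w) ↦ -tr(Y⁻¹ u Y⁻¹ w), symmetric by cyclicity of the trace. This is
closedness of d log |det Y|, obtained without introducing the determinant. -/
theorem hasFDerivAt_logDetCovector {y : FrameModel n} (hy : y ∈ frameDomain n) :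
    ∃ D : FrameModel n →L[ℝ] FrameModel n →L[ℝ] ℝ,
      HasFDerivAt logDetCovector D y ∧ ∀ u w, D u w = D w u := by
  obtain ⟨D, hD, hD'⟩ := hasFDerivAt_inverse hy
  have h1 : HasFDerivAt (fun y : FrameModel n => traceCovectorL n y.2.1.inverse)
      ((traceCovectorL n).comp (D.comp (linearPart n))) y :=
    (traceCovectorL n).hasFDerivAt.comp y
      (HasFDerivAt.comp y (f := linearPart n) hD (linearPart n).hasFDerivAt)
  refine ⟨_, h1.congr_of_eventuallyEq ?_, fun u w => ?_⟩
  · filter_upwards [isOpen_frameDomain.mem_nhds hy] with z hz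
    exact logDetCovector_eq hz
  · change traceCovectorL n (D u.2.1) w = traceCovectorL n (D w.2.1) u
    rw [traceCovectorL_apply, traceCovectorL_apply, hD', hD']
    have := sum_comp_comm (y.2.1.inverse.comp u.2.1) (y.2.1.inverse.comp w.2.1)
    simpa using this

theorem contDiffOn_logDetCovector : ContDiffOn ℝ ∞ (logDetCovector (n := n)) (frameDomain n) := by
  refine ContDiffOn.congr (f := fun y => traceCovectorL n y.2.1.inverse) ?_
    fun y hy => logDetCovector_eq hy
  intro y hy
  have hi : y.2.1.IsInvertible := hy
  exact ((traceCovectorL n).contDiff.contDiffAt.comp y (hi.contDiffAt_map_inverse.comp y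
    (contDiffAt_fst.comp y contDiffAt_snd))).contDiffWithinAt

theorem contractCovector_eq (y : FrameModel n) :
    contractCovector y = ∑ k, ∑ l, dy₂ k k l y • dy l := rfl

variable (n) in
/-- The covectors `yᵏₖₗ dyˡ`, linear in `y`. -/
def contractCovectorL : FrameModel n →L[ℝ] FrameModel n →L[ℝ] ℝ :=
  ∑ k, ∑ l, (dy₂ k k l).smulRight (dy l)

theorem contractCovectorL_apply (y : FrameModel n) :
    contractCovectorL n y = contractCovector y := by
  simp [contractCovectorL, contractCovector_eq]

variable (n) in
/-- Covectors as alternating forms of degree one, as a linear map. -/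
def toFormL : (FrameModel n →L[ℝ] ℝ) →L[ℝ] FrameModel n [⋀^Fin 1]→L[ℝ] ℝ :=
  (ContinuousAlternatingMap.ofSubsingletonLIE (𝕜 := ℝ) (E := FrameModel n) (F := ℝ)
    (0 : Fin 1)).toContinuousLinearEquiv.toContinuousLinearMap

theorem toFormL_apply (a : FrameModel n →L[ℝ] ℝ) : toFormL n a = toForm a := rfl

theorem contDiffOn_gammaCoord : ContDiffOn ℝ ∞ (gammaCoord (n := n)) (frameDomain n) := by
  have h : ContDiffOn ℝ ∞ (fun y : FrameModel n => -logDetCovector y + contractCovector y)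
      (frameDomain n) := by
    simp only [← contractCovectorL_apply]
    exact contDiffOn_logDetCovector.neg.add (contractCovectorL n).contDiff.contDiffOn
  exact (toFormL n).contDiff.comp_contDiffOn h

theorem wedge_toForm_apply (a b : FrameModel n →L[ℝ] ℝ) (v : Fin 2 → FrameModel n) :
    wedge rfl (toForm a) (toForm b) v = a (v 0) * b (v 1) - a (v 1) * b (v 0) := by
  refine (wedge_ofSubsingleton_apply a (toForm b) v).trans ?_
  rw [Fin.sum_univ_two]
  have e : Fin.tail v 0 = v 1 := rfl
  simp [toForm, Fin.removeNth, sub_eq_add_neg, e]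

theorem omegaCoord_apply (v : Fin 2 → FrameModel n) :
    omegaCoord n v = contractCovector (v 0) (v 1) - contractCovector (v 1) (v 0) := by
  simp only [omegaCoord, ContinuousAlternatingMap.sum_apply, sum_apply, wedge_toForm_apply,
    contractCovector_eq, smul_apply, smul_eq_mul, Finset.sum_sub_distrib]

/-- The symmetric derivative of the log-determinant part cancels under antisymmetrization. The other
part is linear in y, so its antisymmetrization is constant and equals ω. -/
theorem extDeriv_gammaCoord {y : FrameModel n} (hy : y ∈ frameDomain n) :
    extDeriv gammaCoord y = omegaCoord n := by
  obtain ⟨D, hD, hs⟩ := hasFDerivAt_logDetCovector hy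
  have h : HasFDerivAt (fun y : FrameModel n => -logDetCovector y + contractCovector y)
      (-D + contractCovectorL n) y := by
    simp only [← contractCovectorL_apply]
    exact hD.neg.add (contractCovectorL n).hasFDerivAt
  have h2 : HasFDerivAt gammaCoord ((toFormL n).comp (-D + contractCovectorL n)) y :=
    (toFormL n).hasFDerivAt.comp y h
  ext v
  rw [extDeriv, h2.fderiv, ContinuousAlternatingMap.alternatizeUncurryFin_apply,
    Fin.sum_univ_two, omegaCoord_apply]
  have e (u : FrameModel n) (w : Fin 1 → FrameModel n) :
      (toFormL n).comp (-D + contractCovectorL n) u w = -D u (w 0) + contractCovector u (w 0) := by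
    rw [← contractCovectorL_apply]
    rfl
  have e0 : (0 : Fin 2).removeNth v 0 = v 1 := rfl
  have e1 : (1 : Fin 2).removeNth v 0 = v 0 := rfl
  rw [e, e, e0, e1, hs (v 1) (v 0)]
  simp
  ring

theorem coordForm_eq (y : FrameModel n) :
    coordForm y = wedgeLeftL (wedgePow (omegaCoord n) n) (-logDetCovector y) := by
  have h : -∑ i, ∑ j, (frameMatrix y)⁻¹ j i • toForm (dy₁ i j) = toForm (-logDetCovector y) := by
    simp only [← toFormL_apply, logDetCovector, map_neg, map_sum, map_smul]
  rw [wedgeLeftL_apply, coordForm, h]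
  rfl

theorem extDeriv_coordForm {y : FrameModel n} (hy : y ∈ frameDomain n) :
    extDeriv coordForm y = 0 := by
  obtain ⟨D, hD, hs⟩ := hasFDerivAt_logDetCovector hy
  have h := extDeriv_wedgeLeftL (wedgePow (omegaCoord n) n) hD.neg
    (fun u w => congrArg Neg.neg (hs u w))
  rw [← h]
  exact congrArg (fun f => extDeriv f y) (funext coordForm_eq)

theorem contDiffOn_coordForm : ContDiffOn ℝ ∞ (coordForm (n := n)) (frameDomain n) := by
  rw [funext (coordForm_eq (n := n))]
  exact (wedgeLeftL _).contDiff.comp_contDiffOn contDiffOn_logDetCovector.neg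

variable (n) in
/-- The common kernel of the covectors `dyⁱ`. -/
def verticalSet : Set (FrameModel n) := {w | w.1 = 0}

theorem isFiltered_of_dy {r : ℕ} {η : FrameModel n [⋀^Fin r]→L[ℝ] ℝ}
    (h : ∀ v, (∀ i, v i ∈ verticalSet n) → η v = 0) : IsFiltered (verticalSet n) 1 η := by
  intro v hv
  have h0 := (Set.ncard_eq_zero).1 (Nat.lt_one_iff.1 hv)
  refine h v fun i => ?_
  by_contra hi
  exact (h0 ▸ hi : i ∈ (∅ : Set (Fin r)))

theorem contractCovector_vertical (y : FrameModel n) {w : FrameModel n}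
    (hw : w ∈ verticalSet n) : contractCovector y w = 0 := by
  have h : w.1 = 0 := hw
  simp [contractCovector, dy, h]

theorem isFiltered_omegaCoord : IsFiltered (verticalSet n) 1 (omegaCoord n) :=
  isFiltered_of_dy fun v hv => by
    rw [omegaCoord_apply, contractCovector_vertical _ (hv 0), contractCovector_vertical _ (hv 1),
      sub_zero]

theorem isFiltered_contractCovector (y : FrameModel n) :
    IsFiltered (verticalSet n) 1 (toForm (contractCovector y)) :=
  isFiltered_of_dy fun _ hv => contractCovector_vertical y (hv 0)

theorem IsFiltered.eq_zero_of_vertical {m r : ℕ} (hm : n < m)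
    {η : FrameModel n [⋀^Fin r]→L[ℝ] ℝ} (hη : IsFiltered (verticalSet n) m η) : η = 0 := by
  -- A basis adapted to the splitting: n standard vectors in the directions yⁱ, and an arbitrary
  -- basis of the remaining directions, all of which are vertical.
  refine hη.eq_zero ((EuclideanSpace.basisFun (Fin n) ℝ).toBasis.prod
    (Module.finBasis ℝ ((Euc n →L[ℝ] Euc n) × (Sym2 (Fin n) → Euc n)))) (fun k => ?_)
    (by simpa using hm)
  simp [verticalSet]

/-- The covector yᵏₖₗ dyˡ and each of the n factors ω need at least one non-vertical argument. Their
product would need n + 1 of them, while only n directions are non-vertical. -/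
theorem wedge_gammaCoord (y : FrameModel n) :
    wedge (Nat.add_comm 1 (2 * n)) (gammaCoord y) (wedgePow (omegaCoord n) n) = coordForm y := by
  have h : gammaCoord y = toForm (-logDetCovector y) + toForm (contractCovector y) :=
    map_add (toFormL n) _ _
  have h2 : wedge (Nat.add_comm 1 (2 * n)) (toForm (contractCovector y))
      (wedgePow (omegaCoord n) n) = 0 :=
    ((isFiltered_contractCovector y).wedge _ (isFiltered_omegaCoord.wedgePow n)).eq_zero_of_vertical
      (by omega)
  rw [h, wedge_add_left, h2, add_zero, coordForm_eq, wedgeLeftL_apply]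
  rfl

end CoordinateForms

/-! ### Forms on S₂(M) with the same expression in all induced charts. -/

section CoordinateFormulas

theorem frameTarget_subset_frameDomain {n : ℕ} {M : Type*} [TopologicalSpace M]
    (φ : OpenPartialHomeomorph M (Euc n)) :
    frameTarget φ ⊆ frameDomain n := fun _ hy => hy.2

variable {n : ℕ} {M : Type*} [TopologicalSpace M] [ChartedSpace (Euc n) M]
  [IsManifold (𝓡 n) ∞ M]

theorem frameChart_coe (φ : OpenPartialHomeomorph M (Euc n)) (hφ : φ ∈ charts n M) :
    (frameChart φ hφ : Frame₂ n M → FrameModel n) = yCoord φ := rfl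

theorem frameChart_source (φ : OpenPartialHomeomorph M (Euc n)) (hφ : φ ∈ charts n M) :
    (frameChart φ hφ).source = proj ⁻¹' φ.source := rfl

theorem frameChart_mem_atlas (φ : OpenPartialHomeomorph M (Euc n)) (hφ : φ ∈ charts n M) :
    frameChart φ hφ ∈ atlas (FrameModel n) (Frame₂ n M) :=
  mem_frame_atlas.2 ⟨φ, hφ, rfl⟩

theorem mdifferentiable_frameChart (φ : OpenPartialHomeomorph M (Euc n)) (hφ : φ ∈ charts n M) :
    (frameChart φ hφ).MDifferentiable 𝓘(ℝ, FrameModel n) 𝓘(ℝ, FrameModel n) := by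
  have : IsManifold 𝓘(ℝ, FrameModel n) 1 (Frame₂ n M) := IsManifold.of_le (n := ∞) (by simp)
  exact mdifferentiable_of_mem_atlas (frameChart_mem_atlas φ hφ)

/-- The form `η` on `S₂(M)` has the same expression `f` in the coordinates induced by every chart
of `M`. -/
def HasCoordFormula {k : ℕ} (η : FrameForm n M k)
    (f : FrameModel n → FrameModel n [⋀^Fin k]→L[ℝ] ℝ) : Prop :=
  ∀ (φ : OpenPartialHomeomorph M (Euc n)) (hφ : φ ∈ charts n M),
    ∀ y ∈ (frameChart φ hφ).target, inChart (frameChart φ hφ) η y = f y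

variable {k : ℕ} {η : FrameForm n M k} {f : FrameModel n → FrameModel n [⋀^Fin k]→L[ℝ] ℝ}

theorem HasCoordFormula.isSmoothForm (h : HasCoordFormula η f)
    (hf : ContDiffOn ℝ ∞ f (frameDomain n)) : IsSmoothForm η := by
  intro e he
  obtain ⟨φ, hφ, rfl⟩ := mem_frame_atlas.1 he
  exact (hf.mono (frameTarget_subset_frameDomain φ)).congr (h φ hφ)

theorem apply_eq_inChart (η : FrameForm n M k) (φ : OpenPartialHomeomorph M (Euc n))
    (hφ : φ ∈ charts n M) {s : Frame₂ n M} (hs : s ∈ (frameChart φ hφ).source) :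
    η s = (inChart (frameChart φ hφ) η (frameChart φ hφ s)).compContinuousLinearMap
      (mfderiv 𝓘(ℝ, FrameModel n) 𝓘(ℝ, FrameModel n) (frameChart φ hφ) s) := by
  have h2 := (mdifferentiable_frameChart φ hφ).symm_comp_deriv hs
  have h3 := (frameChart φ hφ).left_inv hs
  -- The type of `η s` depends on the point, and the chart followed by its inverse returns `s` only
  -- up to a propositional equality. Generalizing over the point and the linear map makes
  -- substitution possible.
  have h4 (s' : Frame₂ n M) (hs' : s' = s) (L : FrameModel n →L[ℝ] FrameModel n)
      (hL : L = ContinuousLinearMap.id ℝ (FrameModel n)) :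
      (show FrameModel n [⋀^Fin k]→L[ℝ] ℝ from η s) =
        (show FrameModel n [⋀^Fin k]→L[ℝ] ℝ from η s').compContinuousLinearMap L := by
    subst hs' hL
    rfl
  exact h4 _ h3 _ h2

theorem HasCoordFormula.apply_eq (h : HasCoordFormula η f) (φ : OpenPartialHomeomorph M (Euc n))
    (hφ : φ ∈ charts n M) {s : Frame₂ n M} (hs : s ∈ (frameChart φ hφ).source) :
    η s = (f (frameChart φ hφ s)).compContinuousLinearMap
      (mfderiv 𝓘(ℝ, FrameModel n) 𝓘(ℝ, FrameModel n) (frameChart φ hφ) s) := by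
  rw [← h φ hφ _ ((frameChart φ hφ).map_source hs)]
  exact apply_eq_inChart η φ hφ hs

theorem trans_mem_charts {e : OpenPartialHomeomorph M M} (he : IsLocalDiffeo n e)
    {ψ : OpenPartialHomeomorph M (Euc n)} (hψ : ψ ∈ charts n M) : e.trans ψ ∈ charts n M := by
  refine OpenPartialHomeomorph.mem_maximalAtlas_of_contMDiffOn _ ?_ ?_
  · rw [OpenPartialHomeomorph.coe_trans]
    exact (contMDiffOn_of_mem_maximalAtlas hψ).comp (he.1.mono fun x hx => hx.1)
      fun x hx => hx.2
  · rw [OpenPartialHomeomorph.coe_trans_symm]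
    exact he.2.comp ((contMDiffOn_symm_of_mem_maximalAtlas hψ).mono fun x hx => hx.1)
      fun x hx => hx.2

theorem proj_prolong {e : OpenPartialHomeomorph M M} (he : IsLocalDiffeo n e) {s : Frame₂ n M}
    (hs : proj s ∈ e.source) : proj (prolong e s) = e (proj s) := by
  have hs' := hs
  rw [← proj_out] at hs'
  have h := prolong_j2 e he (Quotient.out s : LocalParam n M) hs'
  rw [j2_out] at h
  rw [h, ← proj_out s]
  rfl

/-- Both sides read the jet of ψ ∘ e ∘ k: once as ψ applied to e ∘ k, once as the chart ψ ∘ e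
applied to k. -/
theorem yCoord_prolong {e : OpenPartialHomeomorph M M} (he : IsLocalDiffeo n e)
    {ψ : OpenPartialHomeomorph M (Euc n)} (hψ : ψ ∈ charts n M) {s : Frame₂ n M}
    (hs : proj s ∈ (e.trans ψ).source) : yCoord ψ (prolong e s) = yCoord (e.trans ψ) s := by
  rw [← proj_out] at hs
  have h := prolong_j2 e he (Quotient.out s : LocalParam n M) hs.1
  rw [j2_out] at h
  exact h ▸ congrArg zToY
    ((zCoord_j2 hψ ((Quotient.out s : LocalParam n M).push e he hs.1) hs.2))

/-- In the coordinates induced by ψ ∘ e at the source and by ψ at the image, `prolong e` is the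
identity, and `η` has the expression `f` in both. -/
theorem HasCoordFormula.isInvariant (h : HasCoordFormula η f) {P : StructureGroupoid M}
    (hP : ∀ e ∈ P, IsLocalDiffeo n e) : IsInvariant P η := by
  intro e heP s hs
  have he := hP e heP
  have hψ : chartAt (Euc n) (e (proj s)) ∈ charts n M := IsManifold.chart_mem_maximalAtlas _
  set ψ := chartAt (Euc n) (e (proj s)) with hψ'
  have hχ := trans_mem_charts he hψ
  have hsχ : s ∈ (frameChart (e.trans ψ) hχ).source := ⟨hs, mem_chart_source _ _⟩
  have hsψ : prolong e s ∈ (frameChart ψ hψ).source := by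
    rw [frameChart_source, mem_preimage, proj_prolong he hs]
    exact mem_chart_source _ _
  have ev : prolong e =ᶠ[𝓝 s] (frameChart ψ hψ).symm ∘ frameChart (e.trans ψ) hχ := by
    filter_upwards [(frameChart (e.trans ψ) hχ).open_source.mem_nhds hsχ] with t ht
    have ht' : prolong e t ∈ (frameChart ψ hψ).source := by
      rw [frameChart_source, mem_preimage, proj_prolong he ht.1]
      exact ht.2
    rw [comp_apply, frameChart_coe (e.trans ψ), ← yCoord_prolong he hψ ht, ← frameChart_coe ψ hψ,
      (frameChart ψ hψ).left_inv ht']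
  have ev2 : frameChart ψ hψ ∘ prolong e =ᶠ[𝓝 s] frameChart (e.trans ψ) hχ := by
    filter_upwards [(frameChart (e.trans ψ) hχ).open_source.mem_nhds hsχ] with t ht
    exact yCoord_prolong he hψ ht
  have hy : frameChart ψ hψ (prolong e s) = frameChart (e.trans ψ) hχ s := ev2.eq_of_nhds
  -- The chain rule below requires differentiability of `prolong e`; it comes from the factorization
  -- `ev` through the two charts.
  have d1 : MDifferentiableAt 𝓘(ℝ, FrameModel n) 𝓘(ℝ, FrameModel n) (prolong e) s := by
    refine MDifferentiableAt.congr_of_eventuallyEq ?_ ev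
    refine MDifferentiableAt.comp s ?_ ((mdifferentiable_frameChart _ hχ).mdifferentiableAt hsχ)
    refine (mdifferentiable_frameChart _ hψ).mdifferentiableAt_symm ?_
    rw [← hy]
    exact (frameChart ψ hψ).map_source hsψ
  have d2 := mfderiv_comp s ((mdifferentiable_frameChart _ hψ).mdifferentiableAt hsψ) d1
  rw [ev2.mfderiv_eq] at d2
  rw [h.apply_eq ψ hψ hsψ, h.apply_eq (e.trans ψ) hχ hsχ, d2, hy]
  rfl

theorem HasCoordFormula.mem_invForms (h : HasCoordFormula η f)
    (hf : ContDiffOn ℝ ∞ f (frameDomain n)) {P : StructureGroupoid M}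
    (hP : ∀ e ∈ P, IsLocalDiffeo n e) : η ∈ invForms n P k :=
  ⟨h.isSmoothForm hf, h.isInvariant hP⟩

theorem contDiffOn_frameChart_transition {φ ψ : OpenPartialHomeomorph M (Euc n)}
    (hφ : φ ∈ charts n M) (hψ : ψ ∈ charts n M) :
    ContDiffOn ℝ ∞ (frameChart ψ hψ ∘ (frameChart φ hφ).symm)
      ((frameChart φ hφ).symm.trans (frameChart ψ hψ)).source :=
  contDiffOn_frame_transition hφ hψ

theorem fderiv_frameChart_transition {φ ψ : OpenPartialHomeomorph M (Euc n)}
    (hφ : φ ∈ charts n M) (hψ : ψ ∈ charts n M) {y : FrameModel n}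
    (hy : y ∈ ((frameChart φ hφ).symm.trans (frameChart ψ hψ)).source) :
    fderiv ℝ (frameChart ψ hψ ∘ (frameChart φ hφ).symm) y =
      (mfderiv 𝓘(ℝ, FrameModel n) 𝓘(ℝ, FrameModel n) (frameChart ψ hψ)
        ((frameChart φ hφ).symm y)).comp
        (mfderiv 𝓘(ℝ, FrameModel n) 𝓘(ℝ, FrameModel n) (frameChart φ hφ).symm y) := by
  rw [← mfderiv_eq_fderiv]
  exact mfderiv_comp y ((mdifferentiable_frameChart _ hψ).mdifferentiableAt hy.2)
    ((mdifferentiable_frameChart _ hφ).mdifferentiableAt_symm hy.1)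

/-- A uniform expression must be invariant under all coordinate changes of S₂(M), since it describes
the same form on both sides. -/
theorem HasCoordFormula.pullback (h : HasCoordFormula η f) {φ ψ : OpenPartialHomeomorph M (Euc n)}
    (hφ : φ ∈ charts n M) (hψ : ψ ∈ charts n M) {y : FrameModel n}
    (hy : y ∈ ((frameChart φ hφ).symm.trans (frameChart ψ hψ)).source) :
    (f ((frameChart ψ hψ ∘ (frameChart φ hφ).symm) y)).compContinuousLinearMap
      (fderiv ℝ (frameChart ψ hψ ∘ (frameChart φ hφ).symm) y) = f y := by
  rw [← h φ hφ y hy.1, fderiv_frameChart_transition hφ hψ hy]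
  exact congrArg (fun ζ : FrameModel n [⋀^Fin k]→L[ℝ] ℝ => ζ.compContinuousLinearMap
    (mfderiv 𝓘(ℝ, FrameModel n) 𝓘(ℝ, FrameModel n) (frameChart φ hφ).symm y))
    (h.apply_eq ψ hψ hy.2).symm

theorem HasCoordFormula.extD_apply (h : HasCoordFormula η f) (s : Frame₂ n M) :
    extD η s = (extDeriv f (chartAt (FrameModel n) s s)).compContinuousLinearMap
      (mfderiv 𝓘(ℝ, FrameModel n) 𝓘(ℝ, FrameModel n) (chartAt (FrameModel n) s) s) := by
  obtain ⟨ψ, hψ, hc⟩ := mem_frame_atlas.1 (chart_mem_atlas (FrameModel n) s)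
  have ev : inChart (chartAt (FrameModel n) s) η =ᶠ[𝓝 (chartAt (FrameModel n) s s)] f := by
    filter_upwards [(chartAt (FrameModel n) s).open_target.mem_nhds (mem_chart_target _ s)]
      with y hy
    rw [hc] at hy ⊢
    exact h ψ hψ y hy
  rw [extD, ev.extDeriv_eq]

/-- `extD` is computed in a preferred chart that varies with the point. Since `f` is its own
pullback under coordinate changes and d commutes with pullback, `extDeriv f` is also preserved, so
every chart gives the same answer. -/
theorem HasCoordFormula.extD (h : HasCoordFormula η f)
    (hf : ContDiffOn ℝ ∞ f (frameDomain n)) : HasCoordFormula (extD η) (extDeriv f) := by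
  intro φ hφ y hy
  rw [inChart, h.extD_apply]
  obtain ⟨ψ, hψ, hc⟩ :=
    mem_frame_atlas.1 (chart_mem_atlas (FrameModel n) ((frameChart φ hφ).symm y))
  have hs : (frameChart φ hφ).symm y ∈ (frameChart ψ hψ).source := hc ▸ mem_chart_source _ _
  have hm : y ∈ ((frameChart φ hφ).symm.trans (frameChart ψ hψ)).source := ⟨hy, hs⟩
  have ho := ((frameChart φ hφ).symm.trans (frameChart ψ hψ)).open_source.mem_nhds hm
  rw [hc]
  have ev : (fun y => (f ((frameChart ψ hψ ∘ (frameChart φ hφ).symm) y)).compContinuousLinearMap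
      (fderiv ℝ (frameChart ψ hψ ∘ (frameChart φ hφ).symm) y)) =ᶠ[𝓝 y] f := by
    filter_upwards [ho] with z hz
    exact h.pullback hφ hψ hz
  have hd : DifferentiableAt ℝ f ((frameChart ψ hψ ∘ (frameChart φ hφ).symm) y) :=
    (hf.contDiffAt (isOpen_frameDomain.mem_nhds (frameTarget_subset_frameDomain ψ
      ((frameChart ψ hψ).map_source hs)))).differentiableAt (by simp)
  have hp := extDeriv_pullback hd ((contDiffOn_frameChart_transition hφ hψ).contDiffAt ho)
    (by simpa using two_le_infty)
  rw [ev.extDeriv_eq, fderiv_frameChart_transition hφ hψ hm] at hp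
  rw [hp]
  rfl

end CoordinateFormulas

/-! ### Families of maps in ℝⁿ: velocity of the jets and divergence of ξ. -/

section Families

variable {n : ℕ} {G : ℝ × Euc n → Euc n}

theorem fderiv_slice {u : ℝ} {t : Euc n} (hG : DifferentiableAt ℝ G (u, t)) :
    fderiv ℝ (fun t => G (u, t)) t = (fderiv ℝ G (u, t)).comp (ContinuousLinearMap.inr ℝ ℝ _) :=
  (hG.hasFDerivAt.comp t (hasFDerivAt_prodMk_right u t)).fderiv

theorem hasDerivAt_slice {F : Type*} [NormedAddCommGroup F] [NormedSpace ℝ F]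
    {G : ℝ × Euc n → F} {u : ℝ} {t : Euc n} {D : ℝ × Euc n →L[ℝ] F} (hG : HasFDerivAt G D (u, t)) :
    HasDerivAt (fun u => G (u, t)) (D (1, 0)) u :=
  HasFDerivAt.hasDerivAt (f := fun u => G (u, t))
    (HasFDerivAt.comp u (f := fun u : ℝ => (u, t)) hG (hasFDerivAt_prodMk_left u t))

theorem eventually_contDiffAt {p : ℝ × Euc n} (hG : ContDiffAt ℝ ∞ G p) :
    ∀ᶠ p' in 𝓝 p, ContDiffAt ℝ 2 G p' :=
  (hG.of_le two_le_infty).eventually (by simp)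

theorem partial₂_slice {u : ℝ} {t : Euc n} (hG : ContDiffAt ℝ 2 G (u, t)) (p q : Fin n) :
    partial₂ (fun t => G (u, t)) t p q =
      fderiv ℝ (fderiv ℝ G) (u, t) (0, stdVec q) (0, stdVec p) := by
  have ev : ∀ᶠ t' in 𝓝 t, ContDiffAt ℝ 2 G (u, t') :=
    (Continuous.prodMk_right u).continuousAt.eventually (hG.eventually (by simp))
  have e : (fun t' => fderiv ℝ (fun t => G (u, t)) t' (stdVec p)) =ᶠ[𝓝 t]
      fun t' => fderiv ℝ G (u, t') (0, stdVec p) := by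
    filter_upwards [ev] with t' ht'
    rw [fderiv_slice (ht'.differentiableAt (by simp))]
    rfl
  have d : DifferentiableAt ℝ (fderiv ℝ G) (u, t) :=
    (hG.fderiv_right (m := 1) (by norm_num)).differentiableAt (by simp)
  have h := (d.hasFDerivAt.comp t (hasFDerivAt_prodMk_right u t)).clm_apply
    (hasFDerivAt_const ((0, stdVec p) : ℝ × Euc n) t)
  have h2 := e.fderiv_eq.trans h.fderiv
  rw [partial₂, h2]
  simp

/-- The coordinates `y` of the jets at `0` of the maps `G (u, ·)`. -/
def jetCurve (G : ℝ × Euc n → Euc n) (u : ℝ) : FrameModel n := zToY (jet fun t => G (u, t))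

theorem contDiffAt_jetCurve (hG : ContDiffAt ℝ ∞ G (0, 0))
    (hi : (fderiv ℝ (fun t => G (0, t)) 0).IsInvertible) : ContDiffAt ℝ ∞ (jetCurve G) 0 := by
  have hl : ContDiffAt ℝ ∞ (fun u : ℝ => ((u, 0) : ℝ × Euc n)) 0 :=
    contDiffAt_id.prodMk contDiffAt_const
  have ev : ∀ᶠ u : ℝ in 𝓝 0, ContDiffAt ℝ 2 G (u, 0) :=
    hl.continuousAt.eventually (eventually_contDiffAt hG)
  have hD : ContDiffAt ℝ ∞ (fderiv ℝ G) (0, 0) := hG.fderiv_right (m := ∞) (by norm_num)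
  have hD2 : ContDiffAt ℝ ∞ (fderiv ℝ (fderiv ℝ G)) (0, 0) := hD.fderiv_right (m := ∞) (by norm_num)
  have h1 : ContDiffAt ℝ ∞ (fun u : ℝ => fderiv ℝ (fun t => G (u, t)) 0) 0 := by
    refine ContDiffAt.congr_of_eventuallyEq (f := fun u : ℝ =>
      (fderiv ℝ G (u, 0)).comp (ContinuousLinearMap.inr ℝ ℝ _))
      ((hD.comp (0 : ℝ) hl).clm_comp contDiffAt_const) ?_
    filter_upwards [ev] with u hu
    exact fderiv_slice (hu.differentiableAt (by simp))
  have h2 (p q : Fin n) : ContDiffAt ℝ ∞ (fun u : ℝ => partial₂ (fun t => G (u, t)) 0 p q) 0 := by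
    refine ContDiffAt.congr_of_eventuallyEq (f := fun u : ℝ =>
      fderiv ℝ (fderiv ℝ G) (u, 0) (0, stdVec q) (0, stdVec p))
      (((hD2.comp (0 : ℝ) hl).clm_apply contDiffAt_const).clm_apply contDiffAt_const) ?_
    filter_upwards [ev] with u hu
    exact partial₂_slice hu p q
  have h3 : ContDiffAt ℝ ∞ (fun u : ℝ => (fderiv ℝ (fun t => G (u, t)) 0).inverse) 0 :=
    ContDiffAt.comp (0 : ℝ) (g := ContinuousLinearMap.inverse)
      (f := fun u : ℝ => fderiv ℝ (fun t => G (u, t)) 0) hi.contDiffAt_map_inverse h1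
  exact (hG.comp (0 : ℝ) hl).prodMk (h1.prodMk (contDiffAt_symArray (contDiffAt_contract h2 h3)))

theorem deriv_jetCurve_fst (hG : ContDiffAt ℝ ∞ G (0, 0))
    (hi : (fderiv ℝ (fun t => G (0, t)) 0).IsInvertible) :
    (deriv (jetCurve G) 0).1 = fderiv ℝ G (0, 0) (1, 0) := by
  have h := ((contDiffAt_jetCurve hG hi).differentiableAt (by simp)).hasDerivAt
  exact (HasFDerivAt.comp_hasDerivAt (0 : ℝ) (ContinuousLinearMap.fst ℝ (Euc n)
    ((Euc n →L[ℝ] Euc n) × (Sym2 (Fin n) → Euc n))).hasFDerivAt h).unique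
    (hasDerivAt_slice (hG.differentiableAt (by simp)).hasFDerivAt)

theorem deriv_jetCurve_snd (hG : ContDiffAt ℝ ∞ G (0, 0))
    (hi : (fderiv ℝ (fun t => G (0, t)) 0).IsInvertible) :
    (deriv (jetCurve G) 0).2.1 =
      (fderiv ℝ (fderiv ℝ G) (0, 0) (1, 0)).comp (ContinuousLinearMap.inr ℝ ℝ _) := by
  have h := ((contDiffAt_jetCurve hG hi).differentiableAt (by simp)).hasDerivAt
  have h1 := HasFDerivAt.comp_hasDerivAt (0 : ℝ) (linearPart n).hasFDerivAt h
  have ev : ∀ᶠ u : ℝ in 𝓝 0, ContDiffAt ℝ 2 G (u, 0) :=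
    (Continuous.prodMk_left (0 : Euc n)).continuousAt.eventually (eventually_contDiffAt hG)
  have hD : DifferentiableAt ℝ (fderiv ℝ G) (0, 0) :=
    (hG.fderiv_right (m := ∞) (by norm_num)).differentiableAt (by simp)
  have h2 := HasFDerivAt.comp_hasDerivAt (0 : ℝ)
    ((ContinuousLinearMap.compL ℝ (Euc n) (ℝ × Euc n) (Euc n)).flip
      (ContinuousLinearMap.inr ℝ ℝ (Euc n))).hasFDerivAt (hasDerivAt_slice hD.hasFDerivAt)
  refine h1.unique (h2.congr_of_eventuallyEq ?_)
  filter_upwards [ev] with u hu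
  exact fderiv_slice (hu.differentiableAt (by simp))

/-- The contraction of the second order coordinates of a jet with a vector. -/
theorem sum_contract_apply (B : Euc n →L[ℝ] Euc n →L[ℝ] Euc n) (hB : ∀ a b, B a b = B b a)
    (L : Euc n →L[ℝ] Euc n) (g : Euc n) :
    ∑ k, ∑ l, symArray (contract (fun p q => B (stdVec q) (stdVec p)) L) s(k, l) k * g l =
      ∑ j, L (B (stdVec j) (L g)) j := by
  -- Contracting the coefficients of a bilinear map with `L` amounts to evaluating it on the images
  -- under `L`. The double sum thus becomes the trace of B(L g) ∘ L, and cyclicity moves `L` to the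
  -- front.
  have hc (j k : Fin n) : contract (fun p q => B (stdVec q) (stdVec p)) L j k =
      B (L (stdVec k)) (L (stdVec j)) := by
    conv_rhs => rw [← map_sum_stdVec (B (L (stdVec k))) (L (stdVec j))]
    refine Finset.sum_congr rfl fun p _ => ?_
    rw [hB, ← map_sum_stdVec (B (stdVec p)) (L (stdVec k)), Finset.smul_sum]
    refine Finset.sum_congr rfl fun q _ => ?_
    rw [smul_smul, hB]
  have hs (k l : Fin n) : symArray (contract (fun p q => B (stdVec q) (stdVec p)) L) s(k, l) =
      B (L (stdVec k)) (L (stdVec l)) := by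
    rw [symArray_mk (contract_symm (fun p q => hB _ _) L), hc, hB]
  have h1 (k : Fin n) : ∑ l, symArray (contract (fun p q => B (stdVec q) (stdVec p)) L) s(k, l) k
      * g l = B (L g) (L (stdVec k)) k := by
    have h := congrArg (fun x : Euc n => x k) (map_sum_stdVec ((B (L (stdVec k))).comp L) g)
    simp only [hs, hB (L g)]
    refine Eq.trans ?_ h
    simp [mul_comm]
  simp only [h1, hB _ (L g)]
  exact sum_comp_comm (B (L g)) L

/-- If `ξ = -(∂G/∂t)⁻¹ ∂G/∂u` at `u = 0`, the divergence of `ξ` at `0` is the value of the form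
`-vʲᵢ dyⁱⱼ + yᵏₖₗ dyˡ` on the velocity of the curve of jets of the maps `G (u, ·)`. -/
theorem gammaCoord_deriv_jetCurve (hG : ContDiffAt ℝ ∞ G (0, 0))
    (hi : (fderiv ℝ (fun t => G (0, t)) 0).IsInvertible) {ξ : Euc n → Euc n}
    (hξ : DifferentiableAt ℝ ξ 0)
    (h : ∀ᶠ t in 𝓝 (0 : Euc n), fderiv ℝ G (0, t) (0, ξ t) = -fderiv ℝ G (0, t) (1, 0)) :
    gammaCoord (jetCurve G 0) (fun _ => deriv (jetCurve G) 0) =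
      ∑ i, fderiv ℝ ξ 0 (stdVec i) i := by
  set L := fderiv ℝ (fun t => G (0, t)) 0 with hL
  have hL' (x : Euc n) : fderiv ℝ G (0, 0) (0, x) = L x := by
    rw [hL, fderiv_slice (hG.differentiableAt (by simp))]
    rfl
  set D2 := fderiv ℝ (fderiv ℝ G) (0, 0) with hD2
  have hsymm (a b : ℝ × Euc n) : D2 a b = D2 b a :=
    (hG.of_le two_le_infty).isSymmSndFDerivAt (by simp) a b
  have hD : HasFDerivAt (fderiv ℝ G) D2 (0, 0) :=
    ((hG.fderiv_right (m := ∞) (by norm_num)).differentiableAt (by simp)).hasFDerivAt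
  have hDt := hD.comp (0 : Euc n) (hasFDerivAt_prodMk_right (0 : ℝ) (0 : Euc n))
  have e1 := hDt.clm_apply ((hasFDerivAt_const (0 : ℝ) (0 : Euc n)).prodMk hξ.hasFDerivAt)
  have e2 := (hDt.clm_apply (hasFDerivAt_const ((1, 0) : ℝ × Euc n) (0 : Euc n))).neg
  -- Both sides of (∂G/∂t) ξ = -∂G/∂u are differentiated in t at 0; the equation is needed on a
  -- neighbourhood for this.
  have e3 := e1.unique (e2.congr_of_eventuallyEq h)
  have e4 (e : Euc n) : L (fderiv ℝ ξ 0 e) + D2 (0, e) (0, ξ 0) = -D2 (1, 0) (0, e) := by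
    have := congrArg (fun A : Euc n →L[ℝ] Euc n => A e) e3
    rw [hsymm (1, 0), ← hL']
    simpa using this
  set g := fderiv ℝ G (0, 0) (1, 0) with hg
  have e5 : ξ 0 = -L.inverse g := by
    have := h.self_of_nhds
    rw [hL'] at this
    rw [← map_neg, ← this, hi.inverse_apply_self]
  set B : Euc n →L[ℝ] Euc n →L[ℝ] Euc n :=
    (D2.comp (ContinuousLinearMap.inr ℝ ℝ _)).flip.comp (ContinuousLinearMap.inr ℝ ℝ _)
  have hB (a b : Euc n) : B a b = D2 (0, a) (0, b) := hsymm (0, b) (0, a)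
  have hy : jetCurve G 0 ∈ frameDomain n := hi
  have hp : partial₂ (fun t => G (0, t)) 0 = fun p q => B (stdVec q) (stdVec p) := by
    funext p q
    rw [partial₂_slice (hG.of_le two_le_infty), hB]
  -- The velocity has yⁱⱼ-component ∂²G/∂u∂t, yielding the trace of L⁻¹ times the mixed derivative.
  -- In `e7` the coordinates yᵏₖₗ are second t-derivatives contracted with L⁻¹, paired with the
  -- velocity `g` of the base point.
  have e6 : logDetCovector (jetCurve G 0) (deriv (jetCurve G) 0) =
      ∑ j, L.inverse (D2 (1, 0) (0, stdVec j)) j := by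
    rw [logDetCovector_eq hy, traceCovectorL_apply, deriv_jetCurve_snd hG hi]
    rfl
  have e7 : contractCovector (jetCurve G 0) (deriv (jetCurve G) 0) =
      ∑ j, L.inverse (B (stdVec j) (L.inverse g)) j := by
    rw [← sum_contract_apply B (fun a b => by rw [hB, hB, hsymm]), ← hp, hg,
      ← deriv_jetCurve_fst hG hi]
    simp only [contractCovector, sum_apply, smul_apply, smul_eq_mul]
    rfl
  -- The differentiated equation solved for ξ', with ξ(0) = -L⁻¹ g inserted; its trace is the sum of
  -- the two contributions above.
  have e8 (e : Euc n) : fderiv ℝ ξ 0 e =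
      -L.inverse (D2 (1, 0) (0, e)) + L.inverse (B e (L.inverse g)) := by
    have h1 := congrArg L.inverse (e4 e)
    have h2 : ((0, ξ 0) : ℝ × Euc n) = -(0, L.inverse g) := by
      rw [e5]
      simp
    rw [map_add, hi.inverse_apply_self, h2, map_neg, map_neg, map_neg] at h1
    rw [hB, ← h1]
    abel
  change -logDetCovector (jetCurve G 0) (deriv (jetCurve G) 0) +
    contractCovector (jetCurve G 0) (deriv (jetCurve G) 0) = _
  rw [e6, e7, ← Finset.sum_neg_distrib, ← Finset.sum_add_distrib]
  refine Finset.sum_congr rfl fun j _ => ?_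
  rw [e8]
  rfl

end Families

/-! ### Smooth families of parametrizations of M and their velocities. -/

section SmoothFamilies

theorem eq_and_deriv_eq_of_eventually_eq_add_smul {E : Type*} [NormedAddCommGroup E]
    [NormedSpace ℝ E] {Y : ℝ → E} {y w : E} (h : ∀ᶠ u in 𝓝 (0 : ℝ), Y u = y + u • w) :
    Y 0 = y ∧ deriv Y 0 = w := by
  have h1 : HasDerivAt (fun u : ℝ => y + u • w) w 0 := by
    simpa using ((hasDerivAt_id (0 : ℝ)).smul_const w).const_add y
  exact ⟨by simpa using h.self_of_nhds, (h1.congr_of_eventuallyEq h).deriv⟩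

variable {n : ℕ} {M : Type*} [TopologicalSpace M] [ChartedSpace (Euc n) M]

/-- A family of parametrizations read in a chart. -/
def familyInChart (φ : OpenPartialHomeomorph M (Euc n)) (k : ℝ → LocalParam n M)
    (p : ℝ × Euc n) : Euc n := φ ((k p.1).toHomeo p.2)

variable {k : ℝ → LocalParam n M} {φ : OpenPartialHomeomorph M (Euc n)}

theorem IsSmoothFamily.contMDiffAt (hk : IsSmoothFamily k) :
    ContMDiffAt 𝓘(ℝ, ℝ × Euc n) (𝓡 n) ∞ (fun p : ℝ × Euc n => (k p.1).toHomeo p.2) (0, 0) := by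
  obtain ⟨W, hW, h⟩ := hk
  exact h.contMDiffAt hW

theorem IsSmoothFamily.eventually_mem (hk : IsSmoothFamily k)
    (h0 : (k 0).toHomeo 0 ∈ φ.source) :
    ∀ᶠ p : ℝ × Euc n in 𝓝 (0, 0), (k p.1).toHomeo p.2 ∈ φ.source :=
  hk.contMDiffAt.continuousAt.eventually (φ.open_source.mem_nhds h0)

theorem IsSmoothFamily.contDiffAt [IsManifold (𝓡 n) ∞ M] (hk : IsSmoothFamily k)
    (hφ : φ ∈ charts n M) (h0 : (k 0).toHomeo 0 ∈ φ.source) :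
    ContDiffAt ℝ ∞ (familyInChart φ k) (0, 0) := by
  rw [← contMDiffAt_iff_contDiffAt]
  exact ContMDiffAt.comp (I' := 𝓡 n) (g := φ) ((0, 0) : ℝ × Euc n)
    (contMDiffAt_of_mem_maximalAtlas hφ h0) hk.contMDiffAt

theorem isInvertible_familyInChart (hφ : φ ∈ charts n M) (h0 : (k 0).toHomeo 0 ∈ φ.source) :
    (fderiv ℝ (fun t => familyInChart φ k (0, t)) 0).IsInvertible :=
  isInvertible_chart hφ (k 0) h0

theorem IsSmoothFamily.yCoord_eq (hk : IsSmoothFamily k) (hφ : φ ∈ charts n M)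
    (h0 : (k 0).toHomeo 0 ∈ φ.source) :
    (fun u => yCoord φ (j2 (k u))) =ᶠ[𝓝 0] jetCurve (familyInChart φ k) := by
  have hc : Tendsto (fun u : ℝ => ((u, 0) : ℝ × Euc n)) (𝓝 0) (𝓝 (0, 0)) :=
    (Continuous.prodMk_left (0 : Euc n)).tendsto 0
  filter_upwards [hc.eventually (hk.eventually_mem h0)] with u hu
  exact congrArg zToY (zCoord_j2 hφ (k u) hu)

/-- The inverse of a parametrization read in a chart is smooth. -/
theorem contDiffOn_symm_chart (hφ : φ ∈ charts n M) (f : LocalParam n M) :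
    ContDiffOn ℝ ∞ (f.toHomeo.symm ∘ φ.symm) (φ.symm.trans f.toHomeo.symm).source := by
  rw [← contMDiffOn_iff_contDiffOn]
  exact f.smooth_symm.comp ((contMDiffOn_symm_of_mem_maximalAtlas hφ).mono fun x hx => hx.1)
    fun x hx => hx.2

/-- Inserting φ⁻¹ ∘ φ writes k₀⁻¹ ∘ k_u as a fixed smooth map after G(u, ·), and the chain rule
applies. The formula is established for all t near 0 because the field is differentiated afterwards.
-/
theorem IsSmoothFamily.gelfandKazhdanField_eq [IsManifold (𝓡 n) ∞ M] (hk : IsSmoothFamily k)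
    (hφ : φ ∈ charts n M) (h0 : (k 0).toHomeo 0 ∈ φ.source) :
    ∀ᶠ t in 𝓝 (0 : Euc n), familyInChart φ k (0, t) ∈ (φ.symm.trans (k 0).toHomeo.symm).source ∧
      ContDiffAt ℝ 2 (familyInChart φ k) (0, t) ∧
      gelfandKazhdanField k t =
        -fderiv ℝ ((k 0).toHomeo.symm ∘ φ.symm) (familyInChart φ k (0, t))
          (fderiv ℝ (familyInChart φ k) (0, t) (1, 0)) ∧
      (k 0).toHomeo.symm (φ.symm (familyInChart φ k (0, t))) = t := by
  have hc : Tendsto (fun t : Euc n => ((0, t) : ℝ × Euc n)) (𝓝 0) (𝓝 (0, 0)) :=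
    (Continuous.prodMk_right (0 : ℝ)).tendsto 0
  filter_upwards [hc.eventually (hk.eventually_mem h0).eventually_nhds,
    hc.eventually (eventually_contDiffAt (hk.contDiffAt hφ h0)),
    (k 0).toHomeo.open_source.mem_nhds (k 0).zero_mem] with t h1 h2 h3
  have h4 : (k 0).toHomeo t ∈ φ.source := h1.self_of_nhds
  have h5 : φ.symm (familyInChart φ k (0, t)) = (k 0).toHomeo t := φ.left_inv h4
  have hm : familyInChart φ k (0, t) ∈ (φ.symm.trans (k 0).toHomeo.symm).source := by
    refine ⟨φ.map_source h4, ?_⟩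
    change φ.symm (familyInChart φ k (0, t)) ∈ (k 0).toHomeo.target
    rw [h5]
    exact (k 0).toHomeo.map_source h3
  refine ⟨hm, h2, ?_, ?_⟩
  · have hK : DifferentiableAt ℝ ((k 0).toHomeo.symm ∘ φ.symm) (familyInChart φ k (0, t)) :=
      ((contDiffOn_symm_chart hφ (k 0)).contDiffAt
        ((φ.symm.trans (k 0).toHomeo.symm).open_source.mem_nhds hm)).differentiableAt (by simp)
    have h6 := HasFDerivAt.comp_hasDerivAt (0 : ℝ) hK.hasFDerivAt
      (hasDerivAt_slice (h2.differentiableAt (by simp)).hasFDerivAt)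
    have hc2 : Tendsto (fun u : ℝ => ((u, t) : ℝ × Euc n)) (𝓝 0) (𝓝 (0, t)) :=
      (Continuous.prodMk_left t).tendsto 0
    rw [gelfandKazhdanField]
    refine congrArg Neg.neg (h6.congr_of_eventuallyEq ?_).deriv
    filter_upwards [hc2.eventually h1] with u hu
    exact congrArg (k 0).toHomeo.symm (φ.left_inv hu).symm
  · rw [h5, (k 0).toHomeo.left_inv h3]

/-- The form `-vʲᵢ dyⁱⱼ + yᵏₖₗ dyˡ` takes on the velocity of a family of jets the value prescribed
for the trace of the canonical forms. -/
theorem IsSmoothFamily.gammaCoord_deriv [IsManifold (𝓡 n) ∞ M] (hk : IsSmoothFamily k)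
    (hφ : φ ∈ charts n M) (h0 : (k 0).toHomeo 0 ∈ φ.source) :
    gammaCoord (yCoord φ (j2 (k 0))) (fun _ => deriv (fun u => yCoord φ (j2 (k u))) 0) =
      ∑ i, cochain₁ i i (gelfandKazhdanField k) := by
  have hy := hk.yCoord_eq hφ h0
  rw [hy.deriv_eq, hy.eq_of_nhds]
  have hG := hk.contDiffAt hφ h0
  have hev := hk.gelfandKazhdanField_eq hφ h0
  have hc : ContDiffAt ℝ ∞ (fun t : Euc n => ((0, t) : ℝ × Euc n)) 0 :=
    contDiffAt_const.prodMk contDiffAt_id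
  have ho := (φ.symm.trans (k 0).toHomeo.symm).open_source
  refine gammaCoord_deriv_jetCurve hG (isInvertible_familyInChart hφ h0) ?_ ?_
  -- The explicit formula for ξ on a neighbourhood exhibits it as a smooth function of t.
  · have hK : ContDiffAt ℝ ∞ (fderiv ℝ ((k 0).toHomeo.symm ∘ φ.symm)) (familyInChart φ k (0, 0)) :=
      ((contDiffOn_symm_chart hφ (k 0)).contDiffAt (ho.mem_nhds hev.self_of_nhds.1)).fderiv_right
        (m := ∞) (by norm_num)
    have hG0 : ContDiffAt ℝ ∞ (fun t : Euc n => familyInChart φ k (0, t)) 0 := hG.comp 0 hc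
    have hG1 : ContDiffAt ℝ ∞ (fun t : Euc n => fderiv ℝ (familyInChart φ k) (0, t) (1, 0)) 0 :=
      ((hG.fderiv_right (m := ∞) (by norm_num)).comp 0 hc).clm_apply contDiffAt_const
    have h1 := ((hK.comp (0 : Euc n) (f := fun t : Euc n => familyInChart φ k (0, t))
      hG0).clm_apply hG1).neg
    refine (h1.congr_of_eventuallyEq ?_).differentiableAt (by simp)
    filter_upwards [hev] with t ht
    exact ht.2.2.1
  · filter_upwards [hev] with t ht
    obtain ⟨hm, hd, hx, hl⟩ := ht
    have hK : DifferentiableAt ℝ ((k 0).toHomeo.symm ∘ φ.symm) (familyInChart φ k (0, t)) :=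
      ((contDiffOn_symm_chart hφ (k 0)).contDiffAt (ho.mem_nhds hm)).differentiableAt (by simp)
    have hd1 : DifferentiableAt ℝ (familyInChart φ k) (0, t) := hd.differentiableAt (by simp)
    have h1 : HasFDerivAt (fun t => familyInChart φ k (0, t))
        ((fderiv ℝ (familyInChart φ k) (0, t)).comp (ContinuousLinearMap.inr ℝ ℝ _))
        (((k 0).toHomeo.symm ∘ φ.symm) (familyInChart φ k (0, t))) := by
      rw [comp_apply, hl]
      exact hd1.hasFDerivAt.comp t (hasFDerivAt_prodMk_right 0 t)
    have h2 := h1.comp _ hK.hasFDerivAt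
    have h3 : (fun t => familyInChart φ k (0, t)) ∘ ((k 0).toHomeo.symm ∘ φ.symm)
        =ᶠ[𝓝 (familyInChart φ k (0, t))] id := by
      filter_upwards [ho.mem_nhds hm] with z hz
      have hz1 : z ∈ φ.target := hz.1
      have hz2 : φ.symm z ∈ (k 0).toHomeo.target := hz.2
      change φ ((k 0).toHomeo ((k 0).toHomeo.symm (φ.symm z))) = z
      rw [(k 0).toHomeo.right_inv hz2, φ.right_inv hz1]
    -- Differentiating (φ ∘ k₀) ∘ (k₀⁻¹ ∘ φ⁻¹) = id shows that the operator in the formula for ξ is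
    -- a right inverse of ∂G/∂t.
    have h4 := h2.unique ((hasFDerivAt_id _).congr_of_eventuallyEq h3)
    have h5 := congrArg (fun A : Euc n →L[ℝ] Euc n =>
      A (-fderiv ℝ (familyInChart φ k) (0, t) (1, 0))) h4
    rw [hx, ← map_neg]
    exact h5

/-- The inverse function theorem turns the quadratic model jet into a parametrization. Its
underlying map is retained explicitly, so that smooth dependence on `y` can be read off when `y`
varies. -/
theorem exists_quadMap_param (hφ : φ ∈ charts n M)
    {y : FrameModel n} (hy : y ∈ frameTarget φ) :
    ∃ f : LocalParam n M, (f.toHomeo : Euc n → M) = φ.symm ∘ quadMap y ∧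
      f.toHomeo 0 ∈ φ.source ∧ yCoord φ (j2 f) = y := by
  have hi : (fderiv ℝ (quadMap y) 0).IsInvertible := by
    have h : fderiv ℝ (quadMap y) 0 = y.2.1 := congrArg (fun z => z.2.1) (jet_quadMap y)
    rw [h]
    exact hy.2
  obtain ⟨e, he, h0, hs⟩ := exists_localInverse (contDiff_quadMap y) hi
  have hq0 : quadMap y 0 = y.1 := congrArg Prod.fst (jet_quadMap y)
  have hm : (0 : Euc n) ∈ (e.trans φ.symm).source := by
    simp [h0, he, hq0, hy.1]
  have hf0 : (e.trans φ.symm) 0 ∈ φ.source := by simp [he, hq0, φ.map_target hy.1]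
  refine ⟨⟨e.trans φ.symm, hm, ?_, ?_⟩, ?_, hf0, ?_⟩
  · rw [OpenPartialHomeomorph.coe_trans]
    refine (contMDiffOn_symm_of_mem_maximalAtlas hφ).comp (t := φ.target) ?_ fun x hx => hx.2
    rw [he]
    exact (contDiff_quadMap y).contMDiff.contMDiffOn
  · rw [OpenPartialHomeomorph.coe_trans_symm]
    refine (hs.contMDiffOn).comp (t := e.target) ?_ fun x hx => hx.2
    exact (contMDiffOn_of_mem_maximalAtlas hφ).mono (fun x hx => by simpa using hx.1)
  · rw [OpenPartialHomeomorph.coe_trans, he]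
  · rw [yCoord, zCoord_j2 hφ _ hf0]
    refine Eq.trans (congrArg zToY (Eq.trans (jet_congr ?_) (jet_quadMap y))) (zToY_yToZ hy.2)
    filter_upwards [(e.trans φ.symm).open_source.mem_nhds hm] with t ht
    have : quadMap y t ∈ φ.target := by simpa [he] using ht.2
    simp [he, φ.right_inv this]

variable [IsManifold (𝓡 n) ∞ M]

/-- Without this, `mfderiv` could take its default value 0 and the velocity would carry no
information. -/
theorem IsSmoothFamily.mdifferentiableAt (hk : IsSmoothFamily k) :
    MDifferentiableAt 𝓘(ℝ, ℝ) 𝓘(ℝ, FrameModel n) (fun u => j2 (k u)) 0 := by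
  have hφ : chartAt (Euc n) ((k 0).toHomeo 0) ∈ charts n M := IsManifold.chart_mem_maximalAtlas _
  have h0 := mem_chart_source (Euc n) ((k 0).toHomeo 0)
  set φ := chartAt (Euc n) ((k 0).toHomeo 0)
  have hY := hk.yCoord_eq hφ h0
  have hd : DifferentiableAt ℝ (jetCurve (familyInChart φ k)) 0 :=
    (contDiffAt_jetCurve (hk.contDiffAt hφ h0)
      (isInvertible_familyInChart hφ h0)).differentiableAt (by simp)
  have ev : (fun u => j2 (k u)) =ᶠ[𝓝 0]
      (frameChart φ hφ).symm ∘ jetCurve (familyInChart φ k) := by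
    have hc : Tendsto (fun u : ℝ => ((u, 0) : ℝ × Euc n)) (𝓝 0) (𝓝 (0, 0)) :=
      (Continuous.prodMk_left (0 : Euc n)).tendsto 0
    filter_upwards [hY, hc.eventually (hk.eventually_mem h0)] with u hu hu'
    rw [comp_apply, ← hu]
    exact ((frameChart φ hφ).left_inv (x := j2 (k u)) hu').symm
  refine MDifferentiableAt.congr_of_eventuallyEq ?_ ev
  refine MDifferentiableAt.comp (0 : ℝ) ?_ hd.mdifferentiableAt
  refine (mdifferentiable_frameChart φ hφ).mdifferentiableAt_symm ?_
  rw [← hY.eq_of_nhds]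
  exact (frameChart φ hφ).map_source (x := j2 (k 0)) h0

theorem IsSmoothFamily.mfderiv_frameChart (hk : IsSmoothFamily k) (hφ : φ ∈ charts n M)
    (h0 : (k 0).toHomeo 0 ∈ φ.source) :
    mfderiv 𝓘(ℝ, FrameModel n) 𝓘(ℝ, FrameModel n) (frameChart φ hφ) (j2 (k 0))
      (mfderiv 𝓘(ℝ, ℝ) 𝓘(ℝ, FrameModel n) (fun u => j2 (k u)) 0 (1 : ℝ)) =
      deriv (fun u => yCoord φ (j2 (k u))) 0 := by
  have h1 := mfderiv_comp (0 : ℝ) (f := fun u => j2 (k u))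
    ((mdifferentiable_frameChart φ hφ).mdifferentiableAt (x := j2 (k 0)) h0) hk.mdifferentiableAt
  rw [mfderiv_eq_fderiv] at h1
  exact (congrArg (fun A : ℝ →L[ℝ] FrameModel n => A 1) h1).symm

theorem contDiff_quadMap_uncurry :
    ContDiff ℝ ∞ (fun p : FrameModel n × Euc n => quadMap p.1 p.2) := by
  have h1 : ContDiff ℝ ∞ (fun p : FrameModel n × Euc n => p.1.2.1 p.2) :=
    (contDiff_fst.comp (contDiff_snd.comp contDiff_fst)).clm_apply contDiff_snd
  have h2 (s : Sym2 (Fin n)) : ContDiff ℝ ∞ (fun p : FrameModel n × Euc n => p.1.2.2 s) :=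
    contDiff_pi.1 (contDiff_snd.comp (contDiff_snd.comp contDiff_fst)) s
  exact ((contDiff_fst.comp contDiff_fst).add h1).add (ContDiff.const_smul _
    (ContDiff.sum fun j _ => ContDiff.sum fun k _ =>
      (((contDiff_coord j).comp h1).mul ((contDiff_coord k).comp h1)).smul
      (h2 s(j, k))))

/-- Every tangent vector of `S₂(M)` is the velocity of a smooth family of parametrizations. -/
theorem exists_isSmoothFamily (hφ : φ ∈ charts n M) {y : FrameModel n} (hy : y ∈ frameTarget φ)
    (w : FrameModel n) :
    ∃ k : ℝ → LocalParam n M, IsSmoothFamily k ∧ (k 0).toHomeo 0 ∈ φ.source ∧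
      ∀ᶠ u in 𝓝 (0 : ℝ), yCoord φ (j2 (k u)) = y + u • w := by
  classical
  have ho : IsOpen (frameTarget φ) := (frameChart φ hφ).open_target
  have hl : Continuous (fun u : ℝ => y + u • w) := by fun_prop
  have hl0 : y + (0 : ℝ) • w = y := (eq_and_deriv_eq_of_eventually_eq_add_smul
    (Y := fun u : ℝ => y + u • w) (Eventually.of_forall fun _ => rfl)).1
  have hU : ∀ᶠ u in 𝓝 (0 : ℝ), y + u • w ∈ frameTarget φ :=
    hl.continuousAt.eventually (ho.mem_nhds (by
      change y + (0 : ℝ) • w ∈ frameTarget φ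
      rwa [hl0]))
  -- The choice of domains need not vary regularly with `y`: the underlying maps are prescribed by
  -- `hf1`, and only they enter the smoothness condition.
  choose f hf1 hf2 hf3 using fun y hy => exists_quadMap_param hφ (y := y) hy
  -- The straight line from `y` with velocity `w`. Where it leaves the coordinate domain the value
  -- is arbitrary, since only u near 0 matters.
  let k : ℝ → LocalParam n M := fun u =>
    if h : y + u • w ∈ frameTarget φ then f _ h else f y hy
  have hk (u : ℝ) (h : y + u • w ∈ frameTarget φ) : k u = f _ h := dif_pos h
  have hk0 := hk 0 hU.self_of_nhds
  refine ⟨k, ?_, by rw [hk0]; exact hf2 _ _, ?_⟩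
  · let Q : ℝ × Euc n → Euc n := fun p => quadMap (y + p.1 • w) p.2
    have hl1 : ContDiff ℝ ∞ (fun p : ℝ × Euc n => y + p.1 • w) :=
      contDiff_const.add ((ContinuousLinearMap.fst ℝ ℝ (Euc n)).smulRight w).contDiff
    have hQ : ContDiff ℝ ∞ Q := contDiff_quadMap_uncurry.comp (hl1.prodMk contDiff_snd)
    have hQ0 : Q (0, 0) ∈ φ.target := by
      have : quadMap y 0 = y.1 := congrArg Prod.fst (jet_quadMap y)
      change quadMap (y + (0 : ℝ) • w) 0 ∈ φ.target
      rw [hl0, this]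
      exact hy.1
    have hW : ∀ᶠ p : ℝ × Euc n in 𝓝 (0, 0), y + p.1 • w ∈ frameTarget φ ∧ Q p ∈ φ.target :=
      (continuous_fst.continuousAt.eventually hU).and
        (hQ.continuous.continuousAt.eventually (φ.open_target.mem_nhds hQ0))
    refine ⟨{p | y + p.1 • w ∈ frameTarget φ ∧ Q p ∈ φ.target}, hW, ?_⟩
    have h1 : ContMDiffOn 𝓘(ℝ, ℝ × Euc n) (𝓡 n) ∞ (φ.symm ∘ Q)
        {p | y + p.1 • w ∈ frameTarget φ ∧ Q p ∈ φ.target} :=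
      (contMDiffOn_symm_of_mem_maximalAtlas hφ).comp hQ.contMDiff.contMDiffOn fun p hp => hp.2
    refine h1.congr fun p hp => ?_
    rw [hk p.1 hp.1, hf1]
    rfl
  · filter_upwards [hU] with u hu
    rw [hk u hu, hf3]

end SmoothFamilies

/-! ### Existence, uniqueness and coordinate expression of Γ₁. -/

section GammaOne

variable {n : ℕ} {M : Type*} [TopologicalSpace M] [ChartedSpace (Euc n) M]
  [IsManifold (𝓡 n) ∞ M]

/-- The family is a straight line in an induced chart of S₂(M), in the direction of the image of
`v`. The differential of the chart is injective, so the velocity on S₂(M) is `v` itself. -/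
theorem exists_velocity_eq (s : Frame₂ n M) (v : TangentSpace 𝓘(ℝ, FrameModel n) s) :
    ∃ k : ℝ → LocalParam n M, IsSmoothFamily k ∧ j2 (k 0) = s ∧
      (show FrameModel n from
        mfderiv 𝓘(ℝ, ℝ) 𝓘(ℝ, FrameModel n) (fun u => j2 (k u)) 0 (1 : ℝ)) = v := by
  have hφ : chartAt (Euc n) (proj s) ∈ charts n M := IsManifold.chart_mem_maximalAtlas _
  have hs : s ∈ (frameChart (chartAt (Euc n) (proj s)) hφ).source := mem_chart_source _ (proj s)
  set φ := chartAt (Euc n) (proj s)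
  obtain ⟨k, hk, h0, h⟩ := exists_isSmoothFamily hφ ((frameChart φ hφ).map_source hs)
    (mfderiv 𝓘(ℝ, FrameModel n) 𝓘(ℝ, FrameModel n) (frameChart φ hφ) s v)
  have hks : j2 (k 0) = s := by
    refine (frameChart φ hφ).injOn (show j2 (k 0) ∈ (frameChart φ hφ).source from h0) hs ?_
    exact (eq_and_deriv_eq_of_eventually_eq_add_smul h).1
  have h1 := hk.mfderiv_frameChart hφ h0
  rw [(eq_and_deriv_eq_of_eventually_eq_add_smul h).2] at h1
  refine ⟨k, hk, hks, ?_⟩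
  have inj := ((mdifferentiable_frameChart φ hφ).mfderiv_injective hs)
  have h2 (s' : Frame₂ n M) (hs' : s' = s) (x : FrameModel n)
      (hx : (show FrameModel n from mfderiv 𝓘(ℝ, FrameModel n) 𝓘(ℝ, FrameModel n)
        (frameChart φ hφ) s' x) =
        mfderiv 𝓘(ℝ, FrameModel n) 𝓘(ℝ, FrameModel n) (frameChart φ hφ) s v) : x = v := by
    subst hs'
    exact inj hx
  exact h2 _ hks _ h1

theorem IsGammaOne.unique {Γ Γ' : FrameForm n M 1} (h : IsGammaOne Γ) (h' : IsGammaOne Γ') :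
    Γ = Γ' := by
  funext s
  refine ContinuousAlternatingMap.ext fun v => ?_
  obtain ⟨k, hk, rfl, hv⟩ := exists_velocity_eq s (v 0)
  have hv' : v = fun _ => mfderiv 𝓘(ℝ, ℝ) 𝓘(ℝ, FrameModel n) (fun u => j2 (k u)) 0 (1 : ℝ) := by
    funext i
    rw [Subsingleton.elim i 0]
    exact hv.symm
  rw [hv', h k hk, h' k hk]

variable (n M) in
/-- The form `Γ₁`, computed at every point in the preferred chart at that point. -/
def gammaOne : FrameForm n M 1 := fun s =>
  (gammaCoord (chartAt (FrameModel n) s s)).compContinuousLinearMap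
    (mfderiv 𝓘(ℝ, FrameModel n) 𝓘(ℝ, FrameModel n) (chartAt (FrameModel n) s) s)

theorem isGammaOne_gammaOne : IsGammaOne (gammaOne n M) := by
  intro k hk
  obtain ⟨φ, hφ, hc⟩ := mem_frame_atlas.1 (chart_mem_atlas (FrameModel n) (j2 (k 0)))
  have h0 : j2 (k 0) ∈ (frameChart φ hφ).source := hc ▸ mem_chart_source _ _
  rw [gammaOne, hc, ← hk.gammaCoord_deriv hφ h0, ← hk.mfderiv_frameChart hφ h0]
  rfl

/-- Given a chart, a point and a vector, a family realizing the vector computes the form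
intrinsically and `gammaCoord` in that chart. The two agree for every chart, which replaces a check
that `gammaCoord` is invariant under coordinate changes. -/
theorem IsGammaOne.hasCoordFormula {Γ : FrameForm n M 1} (h : IsGammaOne Γ) :
    HasCoordFormula Γ gammaCoord := by
  intro φ hφ y hy
  refine ContinuousAlternatingMap.ext fun v => ?_
  obtain ⟨k, hk, h0, hY⟩ := exists_isSmoothFamily hφ hy (v 0)
  have hy0 : yCoord φ (j2 (k 0)) = y := (eq_and_deriv_eq_of_eventually_eq_add_smul hY).1
  have hd := (eq_and_deriv_eq_of_eventually_eq_add_smul hY).2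
  have h1 := h k hk
  rw [← hk.gammaCoord_deriv hφ h0, apply_eq_inChart Γ φ hφ (s := j2 (k 0)) h0] at h1
  have h2 : (inChart (frameChart φ hφ) Γ (frameChart φ hφ (j2 (k 0)))) (fun _ =>
      mfderiv 𝓘(ℝ, FrameModel n) 𝓘(ℝ, FrameModel n) (frameChart φ hφ) (j2 (k 0))
      (mfderiv 𝓘(ℝ, ℝ) 𝓘(ℝ, FrameModel n) (fun u => j2 (k u)) 0 (1 : ℝ))) = _ := h1
  rw [hk.mfderiv_frameChart hφ h0, hd, frameChart_coe, hy0] at h2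
  have hv : v = fun _ => v 0 := funext fun i => congrArg v (Subsingleton.elim i 0)
  rw [hv]
  exact h2

/-- Pullback by a chart commutes with wedge products, so the expression is γ ∧ (dγ)ⁿ = γ ∧ ωⁿ, to
which `wedge_gammaCoord` applies. -/
theorem HasCoordFormula.gvlForm {Γ : FrameForm n M 1} (h : HasCoordFormula Γ gammaCoord) :
    HasCoordFormula (gvlForm Γ) coordForm := by
  intro φ hφ y hy
  have h2 := h.extD contDiffOn_gammaCoord φ hφ y hy
  rw [extDeriv_gammaCoord (frameTarget_subset_frameDomain φ hy)] at h2
  rw [← wedge_gammaCoord, ← h φ hφ y hy, ← h2]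
  exact (wedge_comp _ _ _ _).trans (congrArg (wedge (Nat.add_comm 1 (2 * n)) _)
    (wedgePow_comp (V := FrameModel n) (W := FrameModel n) _ _ n))

theorem HasCoordFormula.gvlForm_mem_closedForms {Γ : FrameForm n M 1}
    (h : HasCoordFormula Γ gammaCoord) {P : StructureGroupoid M}
    (hP : ∀ e ∈ P, IsLocalDiffeo n e) : Losik.gvlForm Γ ∈ closedForms n P (2 * n + 1) := by
  refine ⟨h.gvlForm.mem_invForms contDiffOn_coordForm hP, ?_⟩
  funext s
  obtain ⟨ψ, hψ, hc⟩ := mem_frame_atlas.1 (chart_mem_atlas (FrameModel n) s)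
  have hs : chartAt (FrameModel n) s s ∈ frameDomain n := by
    have h1 := mem_chart_target (FrameModel n) s
    rw [hc] at h1 ⊢
    exact frameTarget_subset_frameDomain ψ h1
  rw [h.gvlForm.extD_apply, extDeriv_coordForm hs]
  rfl

end GammaOne

end Losik

end

theorem mainTheorem6 (n : ℕ) (M : Type*) [TopologicalSpace M]
    [ChartedSpace (EuclideanSpace ℝ (Fin n)) M] [IsManifold (𝓡 n) ∞ M]
    (P : StructureGroupoid M) (hP : ∀ e ∈ P, Losik.IsLocalDiffeo n e) :
    ∃ Γ₁ ∈ Losik.invForms n P 1,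
      Losik.IsGammaOne Γ₁ ∧ (∀ Γ, Losik.IsGammaOne Γ → Γ = Γ₁) ∧
      ∃ (hΓ : Losik.gvlForm Γ₁ ∈ Losik.closedForms n P (2 * n + 1))
        (η : Losik.FrameForm n M (2 * n + 1)) (hη : η ∈ Losik.closedForms n P (2 * n + 1)),
        (∀ (φ : OpenPartialHomeomorph M (EuclideanSpace ℝ (Fin n))) (hφ : φ ∈ Losik.charts n M),
          ∀ y ∈ (Losik.frameChart φ hφ).target,
            Losik.inChart (Losik.frameChart φ hφ) η y = Losik.coordForm y) ∧
        Losik.cohomologyClass n P (Losik.gvlForm Γ₁) hΓ = Losik.cohomologyClass n P η hη := by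
  have hΓ := Losik.isGammaOne_gammaOne (n := n) (M := M)
  have h := hΓ.hasCoordFormula
  have hc := h.gvlForm_mem_closedForms hP
  -- The representative is Γ₁ ∧ (dΓ₁)ⁿ itself, so the two classes coincide by definition.
  exact ⟨Losik.gammaOne n M, h.mem_invForms Losik.contDiffOn_gammaCoord hP, hΓ,
    fun Γ hΓ' => hΓ'.unique hΓ, hc, Losik.gvlForm (Losik.gammaOne n M), hc, h.gvlForm, rfl⟩
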